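/- Let $n, m_1, m_2\ge 0$ be integers and $d_0,d_1,\dots,d_{m_1},d_1',\dots,d_{m_2}'$ positive integers. Consider real polynomials in $x=(x_1,\dots,x_n)$, $f$ of degree $\le d_0$, $h_i$ of degree $\le d_i$ ($1\le i\le m_1$), $g_j$ of degree $\le d_j'$ ($1\le j\le m_2$), and the problem $$\min f(x)\quad\text{s.t.}\quad h_i(x)=0\ (1\le i\le m_1),\qquad g_j(x)\ge 0\ (1\le j\le m_2)$$ over $x\in\mathbb R^n$, with feasible set $K$. Then there are finitely many polynomials $\varphi_1,\dots,\varphi_L$ with integer coefficients, none identically zero, in the coefficients of $f,h_i,g_j$, depending only on $n$ and the degrees, such that: 1. If $\varphi_1,\dots,\varphi_L$ are all nonzero at the input $(f,h,g)$, then at every local minimizer $u$ of the problem the following hold, where $J(u)=\{j: g_j(u)=0\}$. Constraint qualification: the gradients $\nabla h_i(u)$ (all $i$) and $\nabla g_j(u)$ ($j\in J(u)$) are linearly independent. Moreover there are $\lambda\in\mathbb R^{m_1}$, $\mu\in\mathbb R^{m_2}$ with $\nabla f(u)=\sum_i\lambda_i\nabla h_i(u)+\sum_j\mu_j\nabla g_j(u)$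 and $\mu_j\ge0$, $\mu_jg_j(u)=0$ for all $j$, for which strict complementarity holds, i.e. $\mu_j+g_j(u)>0$ for all $j$, and the second order sufficiency condition holds, i.e. $v^T\nabla^2L(u)v>0$ for every $0\ne v\in\mathbb R^n$ orthogonal to all $\nabla h_i(u)$ and all $\nabla g_j(u)$, $j\in J(u)$, where $L=f-\sum_i\lambda_ih_i-\sum_{j\in J(u)}\mu_jg_j$. 2. The set of inputs at which no $\varphi_l$ vanishes is a nonempty Zariski open subset of the space of inputs. So the conditions in 1 hold on a nonempty Zariski open set of inputs. 3. If $m_1\le n$, then these $\varphi_1,\dots,\varphi_L$ are the following resultants, discriminants, and polynomials $\mathscr R$, $\mathscr D$, one for each item of the list, each described by its zero set on the space of real inputs. Write $\tilde p(x_0,\dots,x_n)=x_0^{e}\,p(x/x_0)$ for the homogenization of an input polynomial $p$ to its prescribed degree bound $e$ ($d_0$, $d_i$ or $d'_j$), and $\nabla_x$, $\nabla_x^2$ for the gradient and Hessian in $x_1,\dots,x_n$ only. For $T\subseteq\{1,\dots,m_2\}$ let $p_1,\dots,p_k$ be the family $h_1,\dots,h_{m_1},g_j\ (j\in T)$, so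 $k=m_1+|T|$. - (a) For each $T$ with $k=n+1$, the resultant: it vanishes if and only if $\tilde p_1=\dots=\tilde p_k=0$ has a solution $0\ne\tilde x\in\mathbb C^{n+1}$. - (b) For each $T$ with $k\le n$, the discriminant: it vanishes if and only if there is $0\ne\tilde x\in\mathbb C^{n+1}$ with $\tilde p_1(\tilde x)=\dots=\tilde p_k(\tilde x)=0$ and $\operatorname{rank}[\nabla\tilde p_1(\tilde x)\ \cdots\ \nabla\tilde p_k(\tilde x)]<k$ (full gradients in $x_0,\dots,x_n$). - (c) For each $T$ with $k\le n$ and each $s\in\{1,\dots,k\}$, the polynomial $\mathscr R(f,(p_i)_{i\ne s};p_s)$: it vanishes if and only if there is $0\ne\tilde x\in\mathbb C^{n+1}$ with $\tilde p_1(\tilde x)=\dots=\tilde p_k(\tilde x)=0$ such that the matrix with columns $\nabla_x\tilde f(\tilde x)$ and $\nabla_x\tilde p_i(\tilde x)$, $i\neq s$, has rank $\le k-1$. - (d) For each $T$ with $k\le n$, the polynomial $\mathscr D(f,p_1,\dots,p_k)$: it vanishes if and only if there are $0\ne\tilde x\in\mathbb C^{n+1}$ and $0\ne y\in\mathbb C^n$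 with $\tilde p_i(\tilde x)=0$ and $(\nabla_x\tilde p_i(\tilde x))^Ty=0$ for all $i$, and $$\operatorname{rank}\begin{bmatrix}\nabla_x\tilde f&\nabla_x\tilde p_1\ \cdots\ \nabla_x\tilde p_k&0\ \cdots\ 0\\(\nabla_x^2\tilde f)y&(\nabla_x^2\tilde p_1)y\ \cdots\ (\nabla_x^2\tilde p_k)y&\nabla_x\tilde p_1\ \cdots\ \nabla_x\tilde p_k\end{bmatrix}(\tilde x)\le 2k.$$ -/

import Mathlib

open MvPolynomial

noncomputable section

namespace PolyOpt

/-! ### Input data and their coefficients -/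

/-- Exponents of the monomials of degree at most `d` in `n` variables. -/
abbrev Expo (n d : ℕ) : Type := {α : Fin n →₀ ℕ // α.degree ≤ d}

/-- The data of the problem `min f(x)` subject to `h i (x) = 0`, `g j (x) ≥ 0` in `n` real
variables, with `f ∈ ℝ[x]_{d₀}`, `h i ∈ ℝ[x]_{d i}`, `g j ∈ ℝ[x]_{d' j}`. -/
structure Input (n : ℕ) {m₁ m₂ : ℕ} (d₀ : ℕ) (d : Fin m₁ → ℕ) (d' : Fin m₂ → ℕ) where
  f : restrictTotalDegree (Fin n) ℝ d₀
  h : ∀ i, restrictTotalDegree (Fin n) ℝ (d i)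
  g : ∀ j, restrictTotalDegree (Fin n) ℝ (d' j)

/-- One indeterminate for every coefficient of `f`, of every `h i` and of every `g j`. -/
abbrev CoeffVar (n : ℕ) {m₁ m₂ : ℕ} (d₀ : ℕ) (d : Fin m₁ → ℕ) (d' : Fin m₂ → ℕ) : Type :=
  Expo n d₀ ⊕ (Σ i, Expo n (d i)) ⊕ (Σ j, Expo n (d' j))

/-! ### Homogenization and complex gradients, Hessians -/

/-- The homogenization `x₀ ^ e * p (x / x₀)` of a polynomial `p` of degree at most `e`; the
homogenizing variable is the one of index `0`. -/
def homog {n : ℕ} (e : ℕ) (p : MvPolynomial (Fin n) ℝ) : MvPolynomial (Fin (n + 1)) ℝ :=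
  ∑ α ∈ p.support, monomial (Finsupp.cons (e - α.degree) α) (p.coeff α)

/-- `∂q/∂x_j` at the complex point `z = (x₀, …, x_n)`. -/
def cderiv {n : ℕ} (q : MvPolynomial (Fin (n + 1)) ℝ) (z : Fin (n + 1) → ℂ) (j : Fin (n + 1)) : ℂ :=
  aeval z (pderiv j q)

/-- `∇_x q`, the derivatives with respect to `x₁, …, x_n` only. -/
def xgrad {n : ℕ} (q : MvPolynomial (Fin (n + 1)) ℝ) (z : Fin (n + 1) → ℂ) : Fin n → ℂ :=
  fun j => cderiv q z j.succ

/-- `∇_x² q`, the second derivatives with respect to `x₁, …, x_n` only. -/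
def xhess {n : ℕ} (q : MvPolynomial (Fin (n + 1)) ℝ) (z : Fin (n + 1) → ℂ) :
    Matrix (Fin n) (Fin n) ℂ :=
  Matrix.of fun i j => cderiv (pderiv i.succ q) z j.succ

/-! ### The degenerate loci of tuples of (homogenized) polynomials -/

section Loci

variable {n : ℕ} {ι : Type} [Fintype ι]

/-- The locus of the resultant: the forms `q i` have a common nonzero complex zero. -/
def HasCommonZero (q : ι → MvPolynomial (Fin (n + 1)) ℝ) : Prop :=
  ∃ z : Fin (n + 1) → ℂ, z ≠ 0 ∧ ∀ i, aeval z (q i) = 0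

/-- The locus of the discriminant of several forms: the forms `q i` have a common nonzero complex
zero at which the rank of the matrix of their gradients is smaller than their number. -/
def HasSingularZero (q : ι → MvPolynomial (Fin (n + 1)) ℝ) : Prop :=
  ∃ z : Fin (n + 1) → ℂ, z ≠ 0 ∧ (∀ i, aeval z (q i) = 0) ∧
    (Matrix.of fun (j : Fin (n + 1)) (i : ι) => cderiv (q i) z j).rank < Fintype.card ι

/-- The locus of the polynomial `𝓡 (p₀, (q i)ᵢ; r)`, with `k` the number of the `q i`: the system
`rank [∇_x p₀, (∇_x q i)ᵢ] ≤ k`, `q i = 0` for all `i`, `r = 0`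
has a nonzero complex solution. -/
def KKTMeets (p₀ : MvPolynomial (Fin (n + 1)) ℝ) (q : ι → MvPolynomial (Fin (n + 1)) ℝ)
    (r : MvPolynomial (Fin (n + 1)) ℝ) : Prop :=
  ∃ z : Fin (n + 1) → ℂ, z ≠ 0 ∧
    (Matrix.of fun (j : Fin n) (i : Option ι) => xgrad (i.elim p₀ q) z j).rank
      ≤ Fintype.card ι ∧
    (∀ i, aeval z (q i) = 0) ∧ aeval z r = 0

/-- The block matrix with columns `(∇_x p₀, (∇_x² p₀) y)`, `(∇_x q i, (∇_x² q i) y)` and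
`(0, ∇_x q i)`. -/
def hessMatrix (p₀ : MvPolynomial (Fin (n + 1)) ℝ) (q : ι → MvPolynomial (Fin (n + 1)) ℝ)
    (z : Fin (n + 1) → ℂ) (y : Fin n → ℂ) : Matrix (Fin n ⊕ Fin n) (Option ι ⊕ ι) ℂ :=
  Matrix.fromBlocks
    (Matrix.of fun (j : Fin n) (i : Option ι) => xgrad (i.elim p₀ q) z j)
    0
    (Matrix.of fun (j : Fin n) (i : Option ι) => (xhess (i.elim p₀ q) z).mulVec y j)
    (Matrix.of fun (j : Fin n) (i : ι) => xgrad (q i) z j)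

/-- The locus of the polynomial `𝓓 (p₀, (q i)ᵢ)`, with `k` the number of the `q i`: there are a
nonzero complex `z = (x₀, …, x_n)` and a nonzero complex `y = (y₁, …, y_n)` such that the matrix
above has rank at most `2k`, and `q i = 0`, `(∇_x q i)ᵀ y = 0` for all `i`. -/
def KKTSingular (p₀ : MvPolynomial (Fin (n + 1)) ℝ) (q : ι → MvPolynomial (Fin (n + 1)) ℝ) :
    Prop :=
  ∃ (z : Fin (n + 1) → ℂ) (y : Fin n → ℂ), z ≠ 0 ∧ y ≠ 0 ∧
    (hessMatrix p₀ q z y).rank ≤ 2 * Fintype.card ι ∧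
    (∀ i, aeval z (q i) = 0) ∧ ∀ i, xgrad (q i) z ⬝ᵥ y = 0

end Loci

/-- The list of the polynomials in the genericity condition. `T` is the set `{j₁ < … < j_r}` of
the chosen inequality constraints; the family considered is `(h₁, …, h_{m₁}, g_{j₁}, …, g_{j_r})`. -/
inductive CondIndex (n m₁ m₂ : ℕ) : Type
  /-- the resultant of the family, when it has `n + 1` members -/
  | res (T : Finset (Fin m₂)) (hT : m₁ + T.card = n + 1)
  /-- the discriminant of the family, when it has at most `n` members -/
  | disc (T : Finset (Fin m₂)) (hT : m₁ + T.card ≤ n)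
  /-- `𝓡 (f, the other members; member q)`, when the family has at most `n` members -/
  | kkt (T : Finset (Fin m₂)) (hT : m₁ + T.card ≤ n) (q : Fin m₁ ⊕ T)
  /-- `𝓓 (f, the family)`, when the family has at most `n` members -/
  | hess (T : Finset (Fin m₂)) (hT : m₁ + T.card ≤ n)

/-! ### Optimality conditions for real polynomials -/

/-- The gradient of a polynomial at `u`. -/
def grad {n : ℕ} (p : MvPolynomial (Fin n) ℝ) (u : Fin n → ℝ) : Fin n → ℝ :=
  fun i => eval u (pderiv i p)

/-- The Hessian of a polynomial at `u`. -/
def hessian {n : ℕ} (p : MvPolynomial (Fin n) ℝ) (u : Fin n → ℝ) : Matrix (Fin n) (Fin n) ℝ :=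
  Matrix.of fun i j => eval u (pderiv j (pderiv i p))

namespace Input

variable {n m₁ m₂ d₀ : ℕ} {d : Fin m₁ → ℕ} {d' : Fin m₂ → ℕ}

/-- The vector of all coefficients of the input polynomials. -/
def coeffs (P : Input n d₀ d d') : CoeffVar n d₀ d d' → ℝ
  | Sum.inl α => (P.f : MvPolynomial (Fin n) ℝ).coeff α.1
  | Sum.inr (Sum.inl ⟨i, α⟩) => (P.h i : MvPolynomial (Fin n) ℝ).coeff α.1
  | Sum.inr (Sum.inr ⟨j, α⟩) => (P.g j : MvPolynomial (Fin n) ℝ).coeff α.1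

/-- The homogenization of `f`. -/
def fH (P : Input n d₀ d d') : MvPolynomial (Fin (n + 1)) ℝ :=
  homog d₀ (P.f : MvPolynomial (Fin n) ℝ)

/-- The homogenizations of the `h i`, all `i`, and of the `g j`, `j ∈ T`. -/
def famH (P : Input n d₀ d d') (T : Finset (Fin m₂)) :
    Fin m₁ ⊕ T → MvPolynomial (Fin (n + 1)) ℝ
  | Sum.inl i => homog (d i) (P.h i : MvPolynomial (Fin n) ℝ)
  | Sum.inr j => homog (d' j) (P.g j : MvPolynomial (Fin n) ℝ)

/-- The input lies in the locus that the polynomial with the given index describes. -/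
def Degenerate (P : Input n d₀ d d') : CondIndex n m₁ m₂ → Prop
  | .res T _ => HasCommonZero (P.famH T)
  | .disc T _ => HasSingularZero (P.famH T)
  | .kkt T _ q => KKTMeets P.fH (fun i : {i // i ≠ q} => P.famH T i) (P.famH T q)
  | .hess T _ => KKTSingular P.fH (P.famH T)

/-- The feasible set. -/
def feasible (P : Input n d₀ d d') : Set (Fin n → ℝ) :=
  {x | (∀ i, eval x (P.h i : MvPolynomial (Fin n) ℝ) = 0) ∧
    ∀ j, 0 ≤ eval x (P.g j : MvPolynomial (Fin n) ℝ)}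

/-- `u` is a local minimizer of the problem. -/
def IsLocalMinimizer (P : Input n d₀ d d') (u : Fin n → ℝ) : Prop :=
  u ∈ P.feasible ∧
    IsLocalMinOn (fun x => eval x (P.f : MvPolynomial (Fin n) ℝ)) P.feasible u

open Classical in
/-- The index set `J(u)` of the active inequality constraints. -/
def active (P : Input n d₀ d d') (u : Fin n → ℝ) : Finset (Fin m₂) :=
  Finset.univ.filter fun j => eval u (P.g j : MvPolynomial (Fin n) ℝ) = 0

/-- The constraint qualification condition: the gradients of all equality constraints and of the
active inequality constraints are linearly independent. -/
def CQC (P : Input n d₀ d d') (u : Fin n → ℝ) : Prop :=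
  LinearIndependent ℝ (Sum.elim (fun i => grad (P.h i : MvPolynomial (Fin n) ℝ) u)
    (fun j : P.active u => grad (P.g j : MvPolynomial (Fin n) ℝ) u))

/-- `lam`, `mu` are Lagrange multipliers at `u`: first order optimality and complementarity. -/
def IsMultiplier (P : Input n d₀ d d') (u : Fin n → ℝ) (lam : Fin m₁ → ℝ) (mu : Fin m₂ → ℝ) :
    Prop :=
  grad (P.f : MvPolynomial (Fin n) ℝ) u =
      ∑ i, lam i • grad (P.h i : MvPolynomial (Fin n) ℝ) u +
      ∑ j, mu j • grad (P.g j : MvPolynomial (Fin n) ℝ) u ∧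
    (∀ j, mu j * eval u (P.g j : MvPolynomial (Fin n) ℝ) = 0) ∧ ∀ j, 0 ≤ mu j

/-- Strict complementarity of the multipliers `mu` at `u`. -/
def SCC (P : Input n d₀ d d') (u : Fin n → ℝ) (mu : Fin m₂ → ℝ) : Prop :=
  ∀ j, 0 < mu j + eval u (P.g j : MvPolynomial (Fin n) ℝ)

/-- The Lagrange function, as a polynomial in `x`. -/
def lagrangian (P : Input n d₀ d d') (u : Fin n → ℝ) (lam : Fin m₁ → ℝ) (mu : Fin m₂ → ℝ) :
    MvPolynomial (Fin n) ℝ :=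
  (P.f : MvPolynomial (Fin n) ℝ) - ∑ i, C (lam i) * (P.h i : MvPolynomial (Fin n) ℝ)
    - ∑ j ∈ P.active u, C (mu j) * (P.g j : MvPolynomial (Fin n) ℝ)

/-- The second order sufficiency condition at `u` with multipliers `lam`, `mu`. -/
def SOSC (P : Input n d₀ d d') (u : Fin n → ℝ) (lam : Fin m₁ → ℝ) (mu : Fin m₂ → ℝ) : Prop :=
  ∀ v : Fin n → ℝ, v ≠ 0 →
    (∀ i, grad (P.h i : MvPolynomial (Fin n) ℝ) u ⬝ᵥ v = 0) →
    (∀ j ∈ P.active u, grad (P.g j : MvPolynomial (Fin n) ℝ) u ⬝ᵥ v = 0) →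
    0 < v ⬝ᵥ (hessian (P.lagrangian u lam mu) u).mulVec v

/-- At every local minimizer the constraint qualification condition holds, and there are Lagrange
multipliers with which strict complementarity and the second order sufficiency condition hold
(by the constraint qualification, the multipliers are unique). -/
def OptimalityConditionsHold (P : Input n d₀ d d') : Prop :=
  ∀ u, P.IsLocalMinimizer u → P.CQC u ∧
    ∃ (lam : Fin m₁ → ℝ) (mu : Fin m₂ → ℝ),
      P.IsMultiplier u lam mu ∧ P.SCC u mu ∧ P.SOSC u lam mu

end Input

/-- A set of inputs is Zariski open: it is the complement of the common zero set of some
polynomials in the coefficients. -/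
def IsZariskiOpen {n m₁ m₂ d₀ : ℕ} {d : Fin m₁ → ℕ} {d' : Fin m₂ → ℕ}
    (U : Set (Input n d₀ d d')) : Prop :=
  ∃ S : Set (MvPolynomial (CoeffVar n d₀ d d') ℝ), U = {P | ∃ p ∈ S, eval P.coeffs p ≠ 0}

end PolyOpt

end

noncomputable section

namespace PolyOpt

/-! ### Spanning families and determinants -/

/-! Two independent facts are combined.

Analysis. Let `u` be a local minimizer and `J` its active set. If more than `n` constraints are
active, some `n + 1` of them (all the `h i` included, as `m₁ ≤ n`) vanish at the point `(1, u)`, so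
a resultant vanishes. If the active gradients are dependent, a discriminant vanishes; Euler's
formula supplies the missing `x₀`-derivative. Otherwise the implicit function theorem gives curves
in the active set, hence Lagrange multipliers, their signs and the second order necessary condition.
A zero multiplier makes an `𝓡` vanish. A tangent vector isotropic for the positive semidefinite
Hessian of the Lagrangian is mapped by it into the span of the active gradients, which makes a `𝓓`
vanish. See `optimalityConditionsHold_of_nondegenerate`.

Algebra. Each degenerate locus is the set of real zeros of a nonzero integer polynomial. It is a
zero set by elimination theory: the locus is the projection of a closed set in a product with a
projective or biprojective space. The conditions on the coefficients are minors of Macaulay matrices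
(`exists_finset_eliminating`), finitely many suffice by Noetherianity, and over the reals the sum of
their squares replaces them by one polynomial.

The polynomial is nonzero because the locus is thin, that is, contained in a complex hypersurface.
This is a dimension count on the incidence variety: for a fixed point `z` and fixed multipliers, the
conditions are linear in the coefficients, and forms can be interpolated, so these conditions are
independent; there are more of them than free parameters (`thin_of_linear_conditions`). The locus of
`𝓓` needs a case distinction first, because a form of degree one has no Hessian to adjust
(`mem_locus_of_kktSingular`).

If `m₁ > n`, the resultant of `n + 1` of the equations alone makes the feasible set generically
empty. -/

theorem span_range_eq_top_iff_exists_det_ne_zero {K B J : Type*} [Field K] [Fintype B]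
    [DecidableEq B] (v : J → B → K) :
    Submodule.span K (Set.range v) = ⊤ ↔ ∃ s : B → J, (Matrix.of fun b => v (s b)).det ≠ 0 := by
  constructor
  · intro h
    obtain ⟨κ, a, -, hspan, hli⟩ := exists_linearIndependent' K v
    let b := Module.Basis.mk hli (by rw [hspan, h])
    let e := (Pi.basisFun K B).indexEquiv b
    refine ⟨a ∘ e, ?_⟩
    rw [← isUnit_iff_ne_zero, ← Matrix.isUnit_iff_isUnit_det,
      ← Matrix.linearIndependent_rows_iff_isUnit]
    exact hli.comp e e.injective
  · rintro ⟨s, hs⟩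
    rw [← isUnit_iff_ne_zero, ← Matrix.isUnit_iff_isUnit_det,
      ← Matrix.linearIndependent_rows_iff_isUnit] at hs
    have := hs.span_eq_top_of_card_eq_finrank' (by simp)
    rw [eq_top_iff, ← this]
    apply Submodule.span_mono
    rintro _ ⟨b, rfl⟩
    exact ⟨s b, rfl⟩

/-- Turns a rank bound into polynomial equations. All row selections are allowed; those with a
repeated row give zero minors and add no condition. -/
theorem rank_lt_card_iff_forall_det_eq_zero {K m ι : Type*} [Field K] [Fintype m]
    [Fintype ι] [DecidableEq ι] (A : Matrix m ι K) :
    A.rank < Fintype.card ι ↔ ∀ s : ι → m, (A.submatrix s id).det = 0 := by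
  have h1 : A.rank = Fintype.card ι ↔ Submodule.span K (Set.range A.row) = ⊤ := by
    rw [Matrix.rank_eq_finrank_span_row]
    constructor
    · intro h
      apply Submodule.eq_top_of_finrank_eq
      rw [h]; simp
    · intro h
      rw [h]; simp
  have h2 := span_range_eq_top_iff_exists_det_ne_zero A.row
  have h3 := A.rank_le_card_width
  rw [lt_iff_le_and_ne, and_iff_right h3, Ne, h1, h2]
  push Not
  rfl

theorem rank_lt_card_iff_exists_mulVec_eq_zero {K m ι : Type*} [Field K] [Fintype m]
    [Fintype ι] [DecidableEq ι] (A : Matrix m ι K) :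
    A.rank < Fintype.card ι ↔ ∃ ν : ι → K, ν ≠ 0 ∧ A.mulVec ν = 0 := by
  have h3 := A.rank_le_card_width
  rw [lt_iff_le_and_ne, and_iff_right h3, Ne]
  have := LinearMap.finrank_range_add_finrank_ker A.mulVecLin
  have h4 : A.rank = Fintype.card ι ↔ LinearMap.ker A.mulVecLin = ⊥ := by
    rw [← Submodule.finrank_eq_zero, Matrix.rank]
    simp only [Module.finrank_fintype_fun_eq_card] at this
    omega
  rw [h4, Submodule.eq_bot_iff]
  push Not
  simp [and_comm]

/-! ### Elimination of homogeneous variables -/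

section Elimination

variable {τ κ M : Type*} [AddCommMonoid M]

theorem weightedHomogeneousComponent_mem_span {K : Type*} [CommRing K] {w : τ → M}
    {F : κ → MvPolynomial τ K} {D : κ → M} (hF : ∀ k, IsWeightedHomogeneous w (F k) (D k))
    {x : MvPolynomial τ K} (hx : x ∈ Ideal.span (Set.range F)) (d : M) :
    weightedHomogeneousComponent w d x ∈ Submodule.span K
      (Set.range fun p : {p : (τ →₀ ℕ) × κ // Finsupp.weight w p.1 + D p.2 = d} =>
        monomial p.1.1 (1 : K) * F p.1.2) := by
  classical
  obtain ⟨c, rfl⟩ := Finsupp.mem_ideal_span_range_iff_exists_finsupp.1 hx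
  rw [Finsupp.sum, map_sum]
  refine Submodule.sum_mem _ fun k _ => ?_
  generalize c k = a
  induction a using MvPolynomial.induction_on' with
  | add p q hp hq => rw [add_mul, map_add]; exact add_mem hp hq
  | monomial u r =>
    have h : IsWeightedHomogeneous w (monomial u r * F k) (Finsupp.weight w u + D k) :=
      (isWeightedHomogeneous_monomial w u r rfl).mul (hF k)
    by_cases hd : Finsupp.weight w u + D k = d
    · rw [hd] at h
      rw [h.weightedHomogeneousComponent_same]
      have h1 : monomial u r * F k = r • (monomial u (1 : K) * F k) := by
        rw [smul_eq_C_mul, ← mul_assoc, C_mul_monomial, mul_one]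
      rw [h1]
      exact Submodule.smul_mem _ _ (Submodule.subset_span ⟨⟨(u, k), hd⟩, rfl⟩)
    · rw [h.weightedHomogeneousComponent_ne _ (Ne.symm hd)]
      exact zero_mem _

/-- The coefficient vectors, on the monomials of degree `d`, of the multiples `X ^ a * F k` of
degree `d` of weighted homogeneous polynomials `F k`. -/
def macaulayRow {A : Type*} [CommRing A] (w : τ → M) (F : κ → MvPolynomial τ A) (D : κ → M) (d : M)
    (p : {p : (τ →₀ ℕ) × κ // Finsupp.weight w p.1 + D p.2 = d})
    (b : {b : τ →₀ ℕ // Finsupp.weight w b = d}) : A :=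
  coeff b.1 (monomial p.1.1 1 * F p.1.2)

/-- The ideal is generated by weighted homogeneous elements, so its part of degree `d` is spanned by
the monomial multiples of the generators of that degree, and the rows are the coordinates of these
multiples. That a homogeneous ideal contains a whole graded piece thus becomes a rank condition on
the coefficients. -/
theorem span_macaulayRow_eq_top_iff {K : Type*} [CommRing K] {w : τ → M}
    {F : κ → MvPolynomial τ K} {D : κ → M} (hF : ∀ k, IsWeightedHomogeneous w (F k) (D k)) (d : M)
    [Finite {b : τ →₀ ℕ // Finsupp.weight w b = d}] :
    Submodule.span K (Set.range (macaulayRow w F D d)) = ⊤ ↔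
      ∀ b, Finsupp.weight w b = d → monomial b (1 : K) ∈ Ideal.span (Set.range F) := by
  classical
  have := Fintype.ofFinite {b : τ →₀ ℕ // Finsupp.weight w b = d}
  let π : MvPolynomial τ K →ₗ[K] ({b : τ →₀ ℕ // Finsupp.weight w b = d} → K) :=
    LinearMap.pi fun b => lcoeff K b.1
  have hπ : ∀ b : {b : τ →₀ ℕ // Finsupp.weight w b = d},
      π (monomial b.1 1) = Pi.single b 1 := by
    intro b
    ext b'
    simp [π, Pi.single_apply, coeff_monomial, Subtype.ext_iff, eq_comm]
  have himg : Submodule.span K (Set.range (macaulayRow w F D d)) = Submodule.map π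
      (Submodule.span K (Set.range
        fun p : {p : (τ →₀ ℕ) × κ // Finsupp.weight w p.1 + D p.2 = d} =>
        monomial p.1.1 (1 : K) * F p.1.2)) := by
    rw [Submodule.map_span, ← Set.range_comp]
    rfl
  constructor
  · intro h b hb
    have h1 : π (monomial b 1) ∈ Submodule.span K (Set.range (macaulayRow w F D d)) := by
      rw [h]; trivial
    rw [himg] at h1
    obtain ⟨y, hy, hyb⟩ := h1
    have hyI : y ∈ Ideal.span (Set.range F) ∧ IsWeightedHomogeneous w y d := by
      have : Submodule.span K (Set.range
        fun p : {p : (τ →₀ ℕ) × κ // Finsupp.weight w p.1 + D p.2 = d} =>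
        monomial p.1.1 (1 : K) * F p.1.2) ≤ (Ideal.span (Set.range F)).restrictScalars K ⊓
          weightedHomogeneousSubmodule K w d := by
        rw [Submodule.span_le]
        rintro _ ⟨p, rfl⟩
        refine ⟨Ideal.mul_mem_left _ _ (Ideal.subset_span ⟨_, rfl⟩), ?_⟩
        have := (isWeightedHomogeneous_monomial w p.1.1 (1 : K) rfl).mul (hF p.1.2)
        rw [p.2] at this
        exact this
      exact this hy
    have : y = monomial b 1 := by
      ext u
      by_cases hu : Finsupp.weight w u = d
      · exact congrFun hyb ⟨u, hu⟩
      · rw [hyI.2.coeff_eq_zero u hu, coeff_monomial, if_neg]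
        rintro rfl
        exact hu hb
    rw [← this]
    exact hyI.1
  · intro h
    rw [eq_top_iff, ← (Pi.basisFun K _).span_eq, Submodule.span_le]
    rintro _ ⟨b, rfl⟩
    rw [Pi.basisFun_apply, ← hπ, himg]
    have h1 := weightedHomogeneousComponent_mem_span hF (h b.1 b.2) d
    rw [(isWeightedHomogeneous_monomial w b.1 (1 : K) b.2).weightedHomogeneousComponent_same] at h1
    exact Submodule.mem_map_of_mem h1

/-- The main theorem of elimination theory, for the common zeros at which some monomial from `E`
does not vanish. -/
theorem exists_finset_eliminating {A K : Type*} [CommRing A] [IsNoetherianRing A] [Field K]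
    [IsAlgClosed K] [Finite τ] (w : τ → M) (δ : M) (E : Set (τ →₀ ℕ))
    (hEw : ∀ e ∈ E, Finsupp.weight w e = δ)
    (hE : ∀ (N : ℕ) (b : τ →₀ ℕ), Finsupp.weight w b = (N + 1) • δ →
      ∃ e ∈ E, ∃ a, Finsupp.weight w a = N • δ ∧ b = e + a)
    (hE0 : ∀ b : τ →₀ ℕ, Finsupp.weight w b = 0 → b = 0)
    (hfin : ∀ N : ℕ, Finite {b : τ →₀ ℕ // Finsupp.weight w b = N • δ})
    (F : κ → MvPolynomial τ A) (D : κ → M) (hF : ∀ k, IsWeightedHomogeneous w (F k) (D k)) :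
    ∃ G : Finset A, ∀ ρ : A →+* K, (∀ g ∈ G, ρ g = 0) ↔
      ∃ z : τ → K, (∃ e ∈ E, eval z (monomial e (1 : K)) ≠ 0) ∧
        ∀ k, eval z (MvPolynomial.map ρ (F k)) = 0 := by
  classical
  -- All maximal minors of the Macaulay matrices in the degrees `N • δ`, an infinite family in `A`.
  -- Its ideal is finitely generated, and `G` is a set of generators.
  let Φ : (Σ N : ℕ, ({b : τ →₀ ℕ // Finsupp.weight w b = N • δ} →
      {p : (τ →₀ ℕ) × κ // Finsupp.weight w p.1 + D p.2 = N • δ})) → A := fun q =>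
    letI := Fintype.ofFinite {b : τ →₀ ℕ // Finsupp.weight w b = q.1 • δ}
    (Matrix.of fun b => macaulayRow w F D (q.1 • δ) (q.2 b)).det
  obtain ⟨G, hG⟩ := (isNoetherianRing_iff_ideal_fg A).1 inferInstance (Ideal.span (Set.range Φ))
  refine ⟨G, fun ρ => ?_⟩
  have h1 : (∀ g ∈ G, ρ g = 0) ↔ ∀ q, ρ (Φ q) = 0 := by
    have e1 : (∀ g ∈ G, ρ g = 0) ↔ Ideal.span (G : Set A) ≤ RingHom.ker ρ := by
      rw [Ideal.span_le]; rfl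
    have e2 : (∀ q, ρ (Φ q) = 0) ↔ Ideal.span (Set.range Φ) ≤ RingHom.ker ρ := by
      rw [Ideal.span_le, Set.range_subset_iff]; rfl
    rw [e1, e2]
    exact (congrArg (· ≤ RingHom.ker ρ) hG).to_iff
  rw [h1]
  set F' : κ → MvPolynomial τ K := fun k => MvPolynomial.map ρ (F k) with hF'def
  have hF' : ∀ k, IsWeightedHomogeneous w (F' k) (D k) := by
    intro k b hb
    rw [hF'def, coeff_map] at hb
    exact hF k fun h => hb (by rw [h, map_zero])
  have hrow : ∀ d, (fun p => ρ ∘ macaulayRow w F D d p) = macaulayRow w F' D d := by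
    intro d
    ext p b
    simp only [Function.comp_apply, macaulayRow, F']
    rw [← coeff_map, map_mul, map_monomial, map_one]
  have h2 : (∀ q, ρ (Φ q) = 0) ↔ ∀ N : ℕ, ¬ ∀ b, Finsupp.weight w b = N • δ →
      monomial b (1 : K) ∈ Ideal.span (Set.range F') := by
    rw [Sigma.forall]
    refine forall_congr' fun N => ?_
    let := Fintype.ofFinite {b : τ →₀ ℕ // Finsupp.weight w b = N • δ}
    rw [← span_macaulayRow_eq_top_iff hF', span_range_eq_top_iff_exists_det_ne_zero, ← hrow]
    push Not
    refine forall_congr' fun s => ?_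
    rw [RingHom.map_det]
    rfl
  rw [h2]
  constructor
  · intro h
    by_contra! hz
    set J : Ideal (MvPolynomial τ K) := Ideal.span ((fun e => monomial e (1 : K)) '' E)
    -- Nullstellensatz: every common zero of the `F'` kills the monomials of `E`. A power of `J`
    -- then lies in the ideal, and `hE` factors each monomial of degree `N • δ` into `N` monomials
    -- from `E`, so it lies in that power.
    have hJ : J ≤ (Ideal.span (Set.range F')).radical := by
      rw [← vanishingIdeal_zeroLocus_eq_radical (K := K), Ideal.span_le]
      rintro _ ⟨e, he, rfl⟩
      rw [SetLike.mem_coe, mem_vanishingIdeal_iff]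
      intro z hzz
      by_contra hne
      obtain ⟨k, hk⟩ := hz z ⟨e, he, by simpa [aeval_eq_eval] using hne⟩
      apply hk
      have := (mem_zeroLocus_iff.1 hzz) (F' k) (Ideal.subset_span ⟨k, rfl⟩)
      rwa [aeval_eq_eval] at this
    obtain ⟨N, hN⟩ := Ideal.exists_pow_le_of_le_radical_of_fg hJ
      ((isNoetherianRing_iff_ideal_fg _).1 inferInstance J)
    refine h N fun b hb => hN ?_
    clear hN
    induction N generalizing b with
    | zero => simp [hE0 b (by simpa using hb)]
    | succ N ih =>
      obtain ⟨e, he, a, ha, rfl⟩ := hE N b hb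
      rw [pow_succ', ← mul_one (1 : K), ← monomial_mul]
      exact Ideal.mul_mem_mul (Ideal.subset_span ⟨e, he, rfl⟩) (ih a ha)
  · rintro ⟨z, ⟨e, he, hez⟩, hz⟩ N h
    -- Conversely, a power of a monomial that is nonzero at `z` cannot lie in an ideal vanishing at
    -- `z`.
    have h3 := h (N • e) (by rw [map_nsmul, hEw e he])
    have h4 : Ideal.span (Set.range F') ≤ RingHom.ker (eval z) := by
      rw [Ideal.span_le, Set.range_subset_iff]
      exact hz
    have h5 : eval z (monomial (N • e) (1 : K)) = 0 := h4 h3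
    rw [← one_pow N, ← monomial_pow, map_pow] at h5
    exact hez (eq_zero_of_pow_eq_zero h5)

end Elimination

section Elimination
variable {κ : Type*}

/-- A finite set of integer polynomials can be replaced by a single one at real points. -/
theorem exists_polynomial_eliminating {τ M C : Type*} [AddCommMonoid M] [Finite τ] [Finite C]
    (w : τ → M) (δ : M) (E : Set (τ →₀ ℕ))
    (hEw : ∀ e ∈ E, Finsupp.weight w e = δ)
    (hE : ∀ (N : ℕ) (b : τ →₀ ℕ), Finsupp.weight w b = (N + 1) • δ →
      ∃ e ∈ E, ∃ a, Finsupp.weight w a = N • δ ∧ b = e + a)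
    (hE0 : ∀ b : τ →₀ ℕ, Finsupp.weight w b = 0 → b = 0)
    (hfin : ∀ N : ℕ, Finite {b : τ →₀ ℕ // Finsupp.weight w b = N • δ})
    (F : κ → MvPolynomial τ (MvPolynomial C ℤ)) (D : κ → M)
    (hF : ∀ k, IsWeightedHomogeneous w (F k) (D k)) :
    ∃ φ : MvPolynomial C ℤ, ∀ c : C → ℝ, aeval c φ = 0 ↔
      ∃ z : τ → ℂ, (∃ e ∈ E, eval z (monomial e (1 : ℂ)) ≠ 0) ∧
        ∀ k, eval z (MvPolynomial.map
          (aeval fun i => (c i : ℂ) : MvPolynomial C ℤ →ₐ[ℤ] ℂ).toRingHom (F k)) = 0 := by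
  obtain ⟨G, hG⟩ := exists_finset_eliminating (K := ℂ) w δ E hEw hE hE0 hfin F D hF
  -- At real coefficients the values of the `g` are real, so the sum of squares vanishes only if
  -- every `g` does.
  refine ⟨∑ g ∈ G, g ^ 2, fun c => ?_⟩
  rw [← hG, map_sum]
  simp only [map_pow]
  rw [Finset.sum_eq_zero_iff_of_nonneg fun _ _ => sq_nonneg _]
  refine forall₂_congr fun g _ => ?_
  rw [sq_eq_zero_iff, ← Complex.ofReal_eq_zero]
  have : ((aeval c g : ℝ) : ℂ) = aeval (fun i => (c i : ℂ)) g := by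
    exact (aeval_algebraMap_apply ℂ c g).symm
  rw [this]
  rfl

end Elimination
-- Thin sets and dimension counts
section Thin
variable {K : Type*} [Field K]

/-- More polynomials than variables are algebraically dependent, by transcendence degree. -/
theorem exists_ne_zero_aeval_eq_zero {A C : Type*} [Fintype A] [Fintype C]
    (h : Fintype.card A < Fintype.card C) (G : C → MvPolynomial A K) :
    ∃ φ : MvPolynomial C K, φ ≠ 0 ∧ aeval G φ = 0 := by
  by_contra! hc
  have hG : AlgebraicIndependent K G := by
    rw [algebraicIndependent_iff]
    intro p hp
    by_contra hne
    exact hc p hne hp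
  have := hG.lift_cardinalMk_le_trdeg
  rw [MvPolynomial.trdeg_of_isDomain] at this
  simp at this
  omega

/-- A set of points is contained in a hypersurface. -/
def Thin {C : Type*} (Z : Set (C → K)) : Prop :=
  ∃ φ : MvPolynomial C K, φ ≠ 0 ∧ ∀ c ∈ Z, eval c φ = 0

theorem Thin.mono {C : Type*} {Z Z' : Set (C → K)} (h : Thin Z') (hZ : Z ⊆ Z') : Thin Z := by
  obtain ⟨φ, h0, h⟩ := h
  exact ⟨φ, h0, fun c hc => h c (hZ hc)⟩

theorem Thin.empty {C : Type*} : Thin (∅ : Set (C → K)) := ⟨1, one_ne_zero, by simp⟩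

theorem Thin.iUnion {C ι : Type*} [Finite ι] {Z : ι → Set (C → K)} (h : ∀ i, Thin (Z i)) :
    Thin (⋃ i, Z i) := by
  have := Fintype.ofFinite ι
  choose φ h0 h using h
  refine ⟨∏ i, φ i, Finset.prod_ne_zero_iff.2 fun i _ => h0 i, fun c hc => ?_⟩
  obtain ⟨i, hi⟩ := Set.mem_iUnion.1 hc
  rw [map_prod]
  exact Finset.prod_eq_zero (Finset.mem_univ i) (h i c hi)

theorem Thin.union {C : Type*} {Z Z' : Set (C → K)} (h : Thin Z) (h' : Thin Z') :
    Thin (Z ∪ Z') := by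
  obtain ⟨φ, h0, h⟩ := h
  obtain ⟨φ', h0', h'⟩ := h'
  refine ⟨φ * φ', mul_ne_zero h0 h0', fun c hc => ?_⟩
  rw [map_mul]
  rcases hc with hc | hc
  · rw [h c hc, zero_mul]
  · rw [h' c hc, mul_zero]

/-- The polynomial functions on affine space. -/
def polyFun (B K : Type*) [Field K] : Subalgebra K ((B → K) → K) :=
  (AlgHom.pi fun t => aeval t : MvPolynomial B K →ₐ[K] (B → K) → K).range

theorem mem_polyFun {B : Type*} {f : (B → K) → K} :
    f ∈ polyFun B K ↔ ∃ Q : MvPolynomial B K, ∀ t, f t = eval t Q := by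
  constructor
  · rintro ⟨Q, rfl⟩
    exact ⟨Q, fun t => rfl⟩
  · rintro ⟨Q, h⟩
    exact ⟨Q, (funext h).symm⟩

/-- The image of a polynomial map from an affine space of smaller dimension is thin. -/
theorem thin_of_parametrized {A C : Type*} [Fintype A] [Fintype C]
    (h : Fintype.card A < Fintype.card C) (G : C → (A → K) → K) (hG : ∀ c, G c ∈ polyFun A K) :
    Thin (Set.range fun (t : A → K) c => G c t) := by
  choose Q hQ using fun c => mem_polyFun.1 (hG c)
  obtain ⟨φ, h0, hφ⟩ := exists_ne_zero_aeval_eq_zero h Q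
  refine ⟨φ, h0, ?_⟩
  rintro _ ⟨t, rfl⟩
  have := congrArg (aeval t) hφ
  rw [map_zero, comp_aeval_apply, aeval_eq_eval, aeval_eq_eval] at this
  simpa [hQ] using this

theorem det_mem_polyFun {B R : Type*} [Fintype R] [DecidableEq R] {M : (B → K) → Matrix R R K}
    (hM : ∀ i j, (fun t => M t i j) ∈ polyFun B K) : (fun t => (M t).det) ∈ polyFun B K := by
  choose Q hQ using fun i j => mem_polyFun.1 (hM i j)
  refine mem_polyFun.2 ⟨(Matrix.of Q).det, fun t => ?_⟩
  rw [RingHom.map_det]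
  congr 1
  ext i j
  exact hQ i j t

theorem adjugate_mem_polyFun {B R : Type*} [Fintype R] [DecidableEq R]
    {M : (B → K) → Matrix R R K} (hM : ∀ i j, (fun t => M t i j) ∈ polyFun B K) (i j : R) :
    (fun t => (M t).adjugate i j) ∈ polyFun B K := by
  choose Q hQ using fun i j => mem_polyFun.1 (hM i j)
  refine mem_polyFun.2 ⟨(Matrix.of Q).adjugate i j, fun t => ?_⟩
  have : M t = (eval t).mapMatrix (Matrix.of Q) := by
    ext i j
    exact hQ i j t
  rw [this, ← RingHom.map_adjugate]
  rfl

theorem eval_mem_polyFun {B : Type*} (Q : MvPolynomial B K) :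
    (fun t => eval t Q) ∈ polyFun B K := mem_polyFun.2 ⟨Q, fun _ => rfl⟩

theorem coord_mem_polyFun {B : Type*} (b : B) : (fun t => t b) ∈ polyFun B K :=
  mem_polyFun.2 ⟨X b, fun t => by simp⟩

theorem comp_mem_polyFun {A B : Type*} {T : (A → K) → B → K}
    (hT : ∀ b, (fun a => T a b) ∈ polyFun A K) {f : (B → K) → K} (hf : f ∈ polyFun B K) :
    (fun a => f (T a)) ∈ polyFun A K := by
  choose P hP using fun b => mem_polyFun.1 (hT b)
  obtain ⟨Q, hQ⟩ := mem_polyFun.1 hf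
  refine mem_polyFun.2 ⟨bind₁ P Q, fun a => ?_⟩
  rw [hQ, ← aeval_eq_eval, ← aeval_eq_eval, aeval_bind₁]
  congr 2
  funext b
  exact hP b a

theorem sum_mem_polyFun {B ι : Type*} (s : Finset ι) {f : ι → (B → K) → K}
    (hf : ∀ i ∈ s, f i ∈ polyFun B K) : (fun t => ∑ i ∈ s, f i t) ∈ polyFun B K := by
  convert (polyFun B K).sum_mem hf using 1
  ext t
  simp

/-- Points satisfying a family of linear conditions that depend polynomially on parameters `t` and
are independent for each `t` form a thin set, if there are more conditions than parameters (not
counting the parameters whose values are prescribed). -/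
theorem thin_of_linear_conditions {B C R : Type*} [Fintype B] [Fintype C] [Fintype R]
    [DecidableEq C] (L : (B → K) → (C → K) →ₗ[K] (R → K))
    (hL : ∀ c r, (fun t => L t (Pi.single c 1) r) ∈ polyFun B K) (S : Finset B) (v : B → K)
    (h : Fintype.card B < Fintype.card R + S.card) :
    Thin {c | ∃ t, (∀ b ∈ S, t b = v b) ∧ Function.Surjective (L t) ∧ L t c = 0} := by
  classical
  -- Needed for `Function.invFun`; it follows from the count, since `S` has at most as many elements
  -- as `B`.
  have : Nonempty R := by
    have := S.card_le_univ
    exact Fintype.card_pos_iff.1 (by omega)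
  -- A surjective `L t` has a nonzero maximal minor. The locus is covered by the finitely many
  -- pieces on which the minor with columns `s` is nonzero, and each piece is parametrized by
  -- Cramer's rule.
  have key : ∀ s : R → C, Thin {c | ∃ t, (∀ b ∈ S, t b = v b) ∧
      (Matrix.of fun r r' => L t (Pi.single (s r') 1) r).det ≠ 0 ∧ L t c = 0} := by
    intro s
    by_cases hs : Function.Injective s
    swap
    · refine Thin.empty.mono ?_
      rintro c ⟨t, -, hdet, -⟩
      simp only [Function.Injective, not_forall] at hs
      obtain ⟨r, r', hrr, hne⟩ := hs
      exact hdet (Matrix.det_zero_of_column_eq hne fun i => by simp [hrr])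
    let W := {w : C // w ∉ Set.range s}
    let A := {b : B // b ∉ S} ⊕ W
    let T : (A → K) → B → K := fun a b => if hb : b ∈ S then v b else a (Sum.inl ⟨b, hb⟩)
    have hT : ∀ f ∈ polyFun B K, (fun a => f (T a)) ∈ polyFun A K := by
      intro f hf
      refine comp_mem_polyFun (fun b => ?_) hf
      by_cases hb : b ∈ S
      · simp only [T, dif_pos hb]
        exact (polyFun A K).algebraMap_mem (v b)
      · simp only [T, dif_neg hb]
        exact coord_mem_polyFun _
    let Δ : (B → K) → Matrix R R K := fun t => Matrix.of fun r r' => L t (Pi.single (s r') 1) r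
    -- The coordinates outside the range of `s` are free, the others are solved for. Taking the free
    -- coordinates as the determinant times a parameter clears the denominator of Cramer's rule, so
    -- that the parametrization is polynomial.
    let G : C → (A → K) → K := fun c a =>
      if hc : c ∈ Set.range s then
        - (Δ (T a)).adjugate.mulVec
          (∑ w : W, a (Sum.inr w) • L (T a) (Pi.single w.1 1)) (s.invFun c)
      else (Δ (T a)).det * a (Sum.inr ⟨c, hc⟩)
    -- The number of parameters is `(|B| - |S|) + (|C| - |R|)`, which is less than `|C|`.
    have hcard : Fintype.card A < Fintype.card C := by
      have h1 : Fintype.card {b : B // b ∉ S} = Fintype.card B - S.card := by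
        rw [Fintype.card_subtype_compl, Fintype.card_coe]
      have h2 : Fintype.card W = Fintype.card C - Fintype.card R := by
        rw [Fintype.card_subtype_compl]
        congr 1
        exact Set.card_range_of_injective hs
      have h3 := Fintype.card_le_of_injective s hs
      have h4 := Finset.card_le_univ S
      rw [Fintype.card_sum, h1, h2]
      omega
    refine (thin_of_parametrized hcard G ?_).mono ?_
    · intro c
      by_cases hc : c ∈ Set.range s
      · simp only [G, dif_pos hc, Matrix.mulVec, dotProduct, Finset.sum_apply, Pi.smul_apply,
          smul_eq_mul]
        refine (polyFun A K).neg_mem (sum_mem_polyFun _ fun r _ => ?_)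
        refine (polyFun A K).mul_mem (x := fun a => (Δ (T a)).adjugate (s.invFun c) r) ?_ ?_
        · exact hT (fun t => (Δ t).adjugate (s.invFun c) r)
            (adjugate_mem_polyFun (fun i j => hL _ _) _ _)
        · refine sum_mem_polyFun _ fun w _ => ?_
          exact (polyFun A K).mul_mem (coord_mem_polyFun _) (hT _ (hL _ _))
      · simp only [G, dif_neg hc]
        exact (polyFun A K).mul_mem (hT _ (det_mem_polyFun fun i j => hL _ _)) (coord_mem_polyFun _)
    · rintro c ⟨t, ht, hdet, hc⟩
      let a : A → K := Sum.elim (fun b => t b.1) fun w => (Δ t).det⁻¹ * c w.1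
      have hTa : T a = t := by
        funext b
        by_cases hb : b ∈ S
        · simp [T, hb, ht b hb]
        · simp [T, hb, a]
      have hsum : (∑ r, c (s r) • Pi.single (s r) (1 : K)) + ∑ w : W, c w.1 • Pi.single w.1 (1 : K)
          = c := by
        have e1 : ∑ x, c x • Pi.single x (1 : K) = c := by
          simpa using ((Pi.basisFun K C).sum_repr c)
        have e2 := Fintype.sum_subtype_add_sum_subtype (· ∈ Set.range s)
          fun x => c x • Pi.single x (1 : K)
        rw [e1] at e2
        refine Eq.trans (congrArg (· + _) ?_) e2
        refine (Fintype.sum_equiv (Equiv.ofInjective s hs) _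
          (fun x => c x.1 • Pi.single x.1 (1 : K)) fun r => rfl).trans ?_
        congr!
      have hlin : (Δ t).mulVec (c ∘ s) + ∑ w : W, c w.1 • L t (Pi.single w.1 1) = 0 := by
        rw [← hc, ← congrArg (L t) hsum, map_add, map_sum, map_sum]
        congr 1
        · ext r
          simp [Matrix.mulVec, dotProduct, Δ, mul_comm]
        · simp
      refine ⟨a, funext fun x => ?_⟩
      by_cases hx : x ∈ Set.range s
      · simp only [G, dif_pos hx, hTa]
        have e3 : ∑ w : W, a (Sum.inr w) • L t (Pi.single w.1 1) =
            (Δ t).det⁻¹ • -(Δ t).mulVec (c ∘ s) := by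
          rw [← eq_neg_iff_add_eq_zero.2 ((add_comm _ _).trans hlin), Finset.smul_sum]
          simp [a, mul_smul]
        rw [e3, Matrix.mulVec_smul, Matrix.mulVec_neg, Matrix.mulVec_mulVec, Matrix.adjugate_mul,
          Matrix.smul_mulVec, Matrix.one_mulVec,
          smul_neg, smul_smul, inv_mul_cancel₀ (show (Δ t).det ≠ 0 from hdet), one_smul,
          Pi.neg_apply, neg_neg]
        exact congrArg c (Function.invFun_eq hx)
      · simp only [G, dif_neg hx, hTa, a, Sum.elim_inr]
        rw [mul_inv_cancel_left₀ hdet]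
  refine (Thin.iUnion key).mono ?_
  rintro c ⟨t, ht, hsurj, hc⟩
  have h1 : Submodule.span K (Set.range fun x => L t (Pi.single x 1)) = ⊤ := by
    have := (Pi.basisFun K C).span_eq
    rw [eq_top_iff, ← LinearMap.range_eq_top.2 hsurj, LinearMap.range_eq_map, ← this,
      Submodule.map_span, ← Set.range_comp]
    apply Submodule.span_mono
    rintro _ ⟨x, rfl⟩
    exact ⟨x, by simp⟩
  obtain ⟨s, hs⟩ := (span_range_eq_top_iff_exists_det_ne_zero _).1 h1
  refine Set.mem_iUnion.2 ⟨s, t, ht, ?_, hc⟩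
  rw [← Matrix.det_transpose]
  exact hs

end Thin

/-- A complex polynomial that vanishes at all real points is zero, the reals being infinite. This
lets the dimension counts be done over `ℂ` while the inputs are real. -/
theorem Thin.exists_real_notMem {C : Type*} [Finite C] {Z : Set (C → ℂ)} (h : Thin Z) :
    ∃ c : C → ℝ, (fun i => (c i : ℂ)) ∉ Z := by
  obtain ⟨φ, h0, h⟩ := h
  by_contra! hc
  refine h0 (funext_set (fun _ => Set.range ((↑) : ℝ → ℂ))
    (fun _ => Set.infinite_range_of_injective Complex.ofReal_injective) fun x hx => ?_)
  choose c hcx using fun i => hx i trivial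
  rw [map_zero, ← h _ (hc c)]
  congr 2
  exact (funext hcx).symm

/-! ### Generic forms -/

instance (n e : ℕ) : Finite (Expo n e) := (Finsupp.finite_of_degree_le e).to_subtype

instance (n e : ℕ) : Fintype (Expo n e) := Fintype.ofFinite _

section Forms

variable {n : ℕ} {I : Type*} {R : Type*} [CommRing R]

/-- The form of index `i` and degree `e i` in a family with given coefficients. -/
def form (e : I → ℕ) (i : I) :
    ((Σ i, Expo n (e i)) → R) →ₗ[R] MvPolynomial (Fin (n + 1)) R :=
  ∑ α : Expo n (e i), monomial (Finsupp.cons (e i - α.1.degree) α.1) ∘ₗ LinearMap.proj ⟨i, α⟩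

theorem form_apply (e : I → ℕ) (i : I) (c : (Σ i, Expo n (e i)) → R) :
    form e i c = ∑ α : Expo n (e i),
      monomial (Finsupp.cons (e i - α.1.degree) α.1) (c ⟨i, α⟩) := by
  simp [form]

theorem degree_cons (a : ℕ) (α : Fin n →₀ ℕ) : (Finsupp.cons a α).degree = a + α.degree := by
  simp [Finsupp.degree_eq_sum, Fin.sum_univ_succ]

theorem form_isHomogeneous (e : I → ℕ) (i : I) (c : (Σ i, Expo n (e i)) → R) :
    (form e i c).IsHomogeneous (e i) := by
  rw [form_apply]
  refine IsHomogeneous.sum _ _ _ fun α _ => isHomogeneous_monomial _ ?_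
  have := α.2
  rw [degree_cons]
  omega

theorem map_form {S : Type*} [CommRing S] (ρ : R →+* S) (e : I → ℕ) (i : I)
    (c : (Σ i, Expo n (e i)) → R) :
    MvPolynomial.map ρ (form e i c) = form e i (ρ ∘ c) := by
  simp [form_apply, map_sum, map_monomial]

/-- Lets interpolation be done with arbitrary homogeneous polynomials and then read off as a
coefficient vector. The exponent of `x₀` is recovered from the degree. -/
theorem exists_form_eq (e : I → ℕ) (q : I → MvPolynomial (Fin (n + 1)) R)
    (hq : ∀ i, (q i).IsHomogeneous (e i)) :
    ∃ c : (Σ i, Expo n (e i)) → R, ∀ i, form e i c = q i := by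
  refine ⟨fun p => coeff (Finsupp.cons (e p.1 - p.2.1.degree) p.2.1) (q p.1), fun i => ?_⟩
  rw [form_apply]
  ext β
  rw [coeff_sum]
  by_cases hβ : β.degree = e i
  · have h1 : β.degree = β 0 + β.tail.degree := by
      conv_lhs => rw [← Finsupp.cons_tail β, degree_cons]
    have h2 : Finsupp.cons (e i - β.tail.degree) β.tail = β := by
      conv_rhs => rw [← Finsupp.cons_tail β]
      congr 1
      omega
    rw [Finset.sum_eq_single (⟨β.tail, by omega⟩ : Expo n (e i))]
    · simp [h2]
    · intro α _ hα
      rw [coeff_monomial, if_neg]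
      rintro rfl
      apply hα
      ext1
      simp
    · simp
  · rw [(hq i).coeff_eq_zero hβ]
    refine Finset.sum_eq_zero fun α _ => ?_
    rw [coeff_monomial, if_neg]
    rintro rfl
    apply hβ
    have := α.2
    rw [degree_cons]
    omega

theorem homog_eq_sum {e : ℕ} (p : restrictTotalDegree (Fin n) ℝ e) :
    homog e (p : MvPolynomial (Fin n) ℝ) = ∑ α : Expo n e,
      monomial (Finsupp.cons (e - α.1.degree) α.1) (coeff α.1 (p : MvPolynomial (Fin n) ℝ)) := by
  rw [homog]
  have hp : ∀ α ∈ (p : MvPolynomial (Fin n) ℝ).support, α.degree ≤ e := by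
    intro α hα
    refine le_trans ?_ ((mem_restrictTotalDegree _ _ _).1 p.2)
    rw [Finsupp.degree_eq_sum]
    have := le_totalDegree hα
    rwa [Finsupp.sum_fintype _ _ fun _ => rfl] at this
  symm
  refine Finset.sum_bij_ne_zero (fun α _ _ => α.1) ?_ ?_ ?_ ?_
  · intro α _ h
    rw [mem_support_iff]
    intro h0
    simp [h0] at h
  · intro α _ _ β _ _ h
    exact Subtype.ext h
  · intro α hα h
    exact ⟨⟨α, hp α hα⟩, Finset.mem_univ _, h, rfl⟩
  · intros; rfl

end Forms

/-! ### Homogeneous polynomials under scaling of the point -/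

section Scaling

variable {σ R : Type*} [CommRing R] {q : MvPolynomial σ R} {e : ℕ}

theorem eval_smul_of_isHomogeneous (hq : q.IsHomogeneous e) (s : R) (z : σ → R) :
    eval (s • z) q = s ^ e * eval z q := by
  rw [eval_eq, eval_eq, Finset.mul_sum]
  refine Finset.sum_congr rfl fun b hb => ?_
  have h1 : b.degree = e := by
    by_contra h
    exact mem_support_iff.1 hb (hq.coeff_eq_zero h)
  simp only [Pi.smul_apply, smul_eq_mul, mul_pow, Finset.prod_mul_distrib]
  rw [Finset.prod_pow_eq_pow_sum, ← Finsupp.degree_apply, h1]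
  ring

/-- The factor `s` on the left avoids the exponent `e - 1`, so the degree zero case needs no
exception. -/
theorem eval_smul_pderiv_of_isHomogeneous (hq : q.IsHomogeneous e) (s : R) (z : σ → R) (m : σ) :
    s * eval (s • z) (pderiv m q) = s ^ e * eval z (pderiv m q) := by
  rcases Nat.eq_zero_or_pos e with rfl | he
  · have : pderiv m q = 0 := by
      rw [← totalDegree_zero_iff_isHomogeneous] at hq
      rw [totalDegree_eq_zero_iff_eq_C.1 hq, pderiv_C]
    simp [this]
  · rw [eval_smul_of_isHomogeneous hq.pderiv, ← mul_assoc, ← pow_succ', Nat.sub_add_cancel he]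

end Scaling

/-! ### Interpolation by forms -/

section Interpolation

variable {K : Type*} [Field K] {n e : ℕ}

/-- The derivative in direction `j` is excluded: Euler's formula ties it to the value and the other
derivatives. -/
theorem exists_form_with_gradient (he : 0 < e) {j : Fin (n + 1)} {z : Fin (n + 1) → K}
    (hz : z j = 1) (a : K) (γ : Fin (n + 1) → K) :
    ∃ q : MvPolynomial (Fin (n + 1)) K, q.IsHomogeneous e ∧ eval z q = a ∧
      ∀ m, m ≠ j → eval z (pderiv m q) = γ m := by
  classical
  -- The linear forms `X m - z m * X j` vanish at `z` and are local coordinates there. The summand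
  -- with `m = j` is zero as `z j = 1`, so `γ j` plays no role.
  refine ⟨C a * X j ^ e + ∑ m, C (γ m) * ((X m - C (z m) * X j) * X j ^ (e - 1)), ?_, ?_, ?_⟩
  · refine IsHomogeneous.add ?_ (IsHomogeneous.sum _ _ _ fun m _ => ?_)
    · exact ((isHomogeneous_X_pow j e)).C_mul a
    · refine IsHomogeneous.C_mul ?_ _
      have := ((isHomogeneous_X K m).sub ((isHomogeneous_X K j).C_mul (z m))).mul
        (isHomogeneous_X_pow (R := K) j (e - 1))
      rwa [Nat.add_sub_cancel' he] at this
  · simp [hz]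
  · intro m hm
    have h1 : ∀ k, pderiv m (X j ^ k : MvPolynomial (Fin (n + 1)) K) = 0 := by
      intro k
      rw [pderiv_pow, pderiv_X_of_ne hm.symm, mul_zero]
    simp only [map_add, map_sum, h1, pderiv_mul, map_sub,
      pderiv_X_of_ne hm.symm, mul_zero, add_zero, map_mul, map_pow, eval_X, hz,
      one_pow, mul_one]
    rw [Finset.sum_eq_single m]
    · simp
    · intro b _ hb
      simp [pderiv_X_of_ne hb]
    · simp

theorem eval_pderiv_mul_mul {σ : Type*} {z : σ → K} {A B : MvPolynomial σ K} (hA : eval z A = 0)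
    (hB : eval z B = 0) (G : MvPolynomial σ K) (m : σ) : eval z (pderiv m (A * B * G)) = 0 := by
  simp [hA, hB]

theorem eval_pderiv_pderiv_mul_mul {σ : Type*} {z : σ → K} {A B : MvPolynomial σ K}
    (hA : eval z A = 0) (hB : eval z B = 0) (G : MvPolynomial σ K) (k m : σ) :
    eval z (pderiv k (pderiv m (A * B * G))) = (eval z (pderiv k A) * eval z (pderiv m B) +
      eval z (pderiv m A) * eval z (pderiv k B)) * eval z G := by
  simp [hA, hB]
  ring

/-- A product of two linear forms vanishing at `z` changes neither the value nor the gradient there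
and adds a symmetric matrix of rank at most two to the Hessian. Such matrices already map a given
nonzero `y` to any vector, so a form with the right value and gradient can be corrected. -/
theorem exists_form_with_hessian (he : 2 ≤ e) {z : Fin (n + 1) → K} (h2 : (2 : K) ≠ 0)
    (hz : z 0 = 1) {y : Fin n → K} {l : Fin n} (hy : y l = 1) (a : K) (γ δ : Fin n → K) :
    ∃ q : MvPolynomial (Fin (n + 1)) K, q.IsHomogeneous e ∧ eval z q = a ∧
      (∀ m : Fin n, eval z (pderiv m.succ q) = γ m) ∧
      ∀ m : Fin n, ∑ k : Fin n, eval z (pderiv k.succ (pderiv m.succ q)) * y k = δ m := by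
  classical
  obtain ⟨q, hq, hqa, hqγ⟩ := exists_form_with_gradient (e := e) (by omega) hz a (Fin.cons 0 γ)
  let δ' : Fin n → K := fun m =>
    δ m - ∑ k : Fin n, eval z (pderiv k.succ (pderiv m.succ q)) * y k
  let ℓ : Fin n → MvPolynomial (Fin (n + 1)) K := fun m => X m.succ - C (z m.succ) * X 0
  have hℓ : ∀ m, (ℓ m).IsHomogeneous 1 := fun m =>
    (isHomogeneous_X K _).sub ((isHomogeneous_X K _).C_mul _)
  have hℓ0 : ∀ m, eval z (ℓ m) = 0 := fun m => by simp [ℓ, hz]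
  have hℓd : ∀ m k : Fin n, eval z (pderiv k.succ (ℓ m)) = if k = m then 1 else 0 := by
    intro m k
    simp only [ℓ, map_sub, pderiv_C_mul, pderiv_X_of_ne (Fin.succ_ne_zero k).symm,
      mul_zero, sub_zero]
    by_cases h : k = m
    · subst h; simp
    · rw [if_neg h, pderiv_X_of_ne fun h' => h (Fin.succ_injective _ h').symm, map_zero]
  -- With `b` the `l`-th unit vector and `a = δ' - (δ' ⬝ᵥ y / 2) b`, the added Hessian maps `y` to
  -- `(b ⬝ᵥ y) a + (a ⬝ᵥ y) b`. Since `b ⬝ᵥ y = 1` and `a ⬝ᵥ y = δ' ⬝ᵥ y / 2`, this is `δ'`.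
  let A := ∑ m, C (δ' m) * ℓ m - C ((∑ k, δ' k * y k) / 2) * ℓ l
  have hA : A.IsHomogeneous 1 :=
    (IsHomogeneous.sum _ _ _ fun m _ => (hℓ m).C_mul _).sub ((hℓ l).C_mul _)
  have hA0 : eval z A = 0 := by simp [A, hℓ0]
  have hAd : ∀ k : Fin n, eval z (pderiv k.succ A) =
      δ' k - (∑ k, δ' k * y k) / 2 * if k = l then 1 else 0 := by
    intro k
    simp [A, hℓd]
  refine ⟨q + A * ℓ l * X 0 ^ (e - 2), hq.add ?_, ?_, fun m => ?_, fun m => ?_⟩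
  · have := (hA.mul (hℓ l)).mul (isHomogeneous_X_pow (R := K) (0 : Fin (n + 1)) (e - 2))
    rwa [show 1 + 1 + (e - 2) = e by omega] at this
  · simp [hqa, hA0]
  · rw [map_add, map_add, eval_pderiv_mul_mul hA0 (hℓ0 l), add_zero, hqγ _ (Fin.succ_ne_zero m)]
    rfl
  · simp only [map_add, eval_pderiv_pderiv_mul_mul hA0 (hℓ0 l), hAd, hℓd, map_pow, eval_X, hz,
      one_pow, mul_one, add_mul, Finset.sum_add_distrib]
    have h3 : ∑ k, (δ' k - (∑ k, δ' k * y k) / 2 * if k = l then 1 else 0) *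
        (if m = l then 1 else 0) * y k =
        (∑ k, δ' k * y k) / 2 * (if m = l then 1 else 0) := by
      have : ∀ k, (δ' k - (∑ k, δ' k * y k) / 2 * if k = l then 1 else 0) *
        (if m = l then 1 else 0) * y k = (if m = l then 1 else 0) *
          (δ' k * y k - if k = l then (∑ k, δ' k * y k) / 2 * y k else 0) := by
        intro k
        split_ifs <;> ring
      simp_rw [this]
      rw [← Finset.mul_sum, Finset.sum_sub_distrib, Finset.sum_ite_eq' Finset.univ l]
      simp only [Finset.mem_univ, if_true, hy]
      field_simp
      ring
    have h4 : ∑ k, (δ' m - (∑ k, δ' k * y k) / 2 * if m = l then 1 else 0) *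
        (if k = l then 1 else 0) * y k = δ' m - (∑ k, δ' k * y k) / 2 *
          (if m = l then 1 else 0) := by
      rw [Finset.sum_eq_single l]
      · simp [hy]
      · intro b _ hb; simp [hb]
      · simp
    rw [h3, h4]
    simp only [δ']
    ring

end Interpolation

/-! ### Thinness of the loci of dependent gradients and of degenerate Hessians -/

section Dependent

variable {K : Type*} [Field K] {n : ℕ} {I : Type*} [Fintype I] [DecidableEq I] {e : I → ℕ}
  {Z D : Type*} [Fintype Z] [Fintype D]

/-- The families of forms of which some have a common nonzero zero with linearly dependent
`x`-gradients of some. -/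
def dependentLocus (e : I → ℕ) (a : Z → I) (b : D → I) : Set ((Σ i, Expo n (e i)) → K) :=
  {c | ∃ z : Fin (n + 1) → K, z ≠ 0 ∧ ∃ ν : D → K, ν ≠ 0 ∧
    (∀ i, eval z (form e (a i) c) = 0) ∧
    ∀ m : Fin n, ∑ i, ν i * eval z (pderiv m.succ (form e (b i) c)) = 0}

theorem eval_form_mem_polyFun {B : Type*} (T : Fin (n + 1) → B)
    (Q : MvPolynomial (Fin (n + 1)) K) : (fun t : B → K => eval (t ∘ T) Q) ∈ polyFun B K := by
  simp_rw [← eval_rename]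
  exact eval_mem_polyFun _

/-- For fixed `z` and `ν` the conditions are linear in the coefficients. They are independent
because values and gradients of forms can be interpolated, and since `ν l = 1` the gradient of the
single form `b l` already produces any right hand side. The direction `j` is omitted because of
Euler's formula; for `j ≠ 0` the prescribed value `z 0 = 0` makes up for the lost condition. -/
theorem thin_dependent_chart (he : ∀ i, 0 < e i) {a : Z → I} {b : D → I}
    (ha : Function.Injective a) (hb : Function.Injective b)
    (h : Fintype.card D ≤ Fintype.card Z) (j : Fin (n + 1)) (l : D) :
    Thin {c : (Σ i, Expo n (e i)) → K | ∃ z : Fin (n + 1) → K, z j = 1 ∧ (j ≠ 0 → z 0 = 0) ∧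
      ∃ ν : D → K, ν l = 1 ∧ (∀ i, eval z (form e (a i) c) = 0) ∧
      ∀ m : Fin n, m.succ ≠ j → ∑ i, ν i * eval z (pderiv m.succ (form e (b i) c)) = 0} := by
  classical
  let B := Fin (n + 1) ⊕ D
  let R := Z ⊕ {m : Fin n // m.succ ≠ j}
  let L : (B → K) → ((Σ i, Expo n (e i)) → K) →ₗ[K] (R → K) := fun t =>
    { toFun := fun c => Sum.elim (fun i => eval (t ∘ Sum.inl) (form e (a i) c))
        fun m => ∑ i, t (Sum.inr i) * eval (t ∘ Sum.inl) (pderiv m.1.succ (form e (b i) c))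
      map_add' := fun c c' => by
        ext (i | m) <;> simp [mul_add, Finset.sum_add_distrib]
      map_smul' := fun s c => by
        ext (i | m)
        · simp
        · simp [Finset.mul_sum, mul_left_comm] }
  let S : Finset B := {Sum.inl 0, Sum.inl j, Sum.inr l}
  let v : B → K := Sum.elim (fun k => if k = j then 1 else 0) fun _ => 1
  have hcard : Fintype.card B < Fintype.card R + S.card := by
    -- For `j = 0` there are `n` gradient conditions and two prescribed parameters, otherwise `n -
    -- 1` and three. Against this stand `n + 1 + |D|` parameters, so `|D| ≤ |Z|` is just enough.
    have h1 : Fintype.card R + S.card = Fintype.card Z + (n + 2) := by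
      rw [Fintype.card_sum, add_assoc]
      congr 1
      cases j using Fin.cases with
      | zero =>
        simp [S, Fin.succ_ne_zero]
      | succ j =>
        have : S.card = 3 := by
          simp only [S]
          rw [Finset.card_insert_of_notMem, Finset.card_pair]
          · simp
          · rw [Finset.mem_insert, Finset.mem_singleton, not_or]
            exact ⟨fun h => Fin.succ_ne_zero j (Sum.inl_injective h).symm, Sum.inl_ne_inr⟩
        rw [this]
        simp only [ne_eq, Fin.succ_inj, Fintype.card_subtype_compl, Fintype.card_fin,
          Fintype.card_unique]
        have := j.pos
        omega
    rw [h1]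
    simp only [B, Fintype.card_sum, Fintype.card_fin]
    omega
  refine (thin_of_linear_conditions L ?_ S v hcard).mono ?_
  · rintro c (i | m)
    · exact eval_form_mem_polyFun _ _
    · refine sum_mem_polyFun _ fun i _ => ?_
      exact (polyFun B K).mul_mem (coord_mem_polyFun _) (eval_form_mem_polyFun _ _)
  · rintro c ⟨z, hzj, hz0, ν, hνl, h1, h2⟩
    refine ⟨Sum.elim z ν, ?_, ?_, ?_⟩
    · intro x hx
      simp only [S, Finset.mem_insert, Finset.mem_singleton] at hx
      rcases hx with rfl | rfl | rfl
      · by_cases hj : j = 0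
        · subst hj; simp [v, hzj]
        · simp [v, hz0 hj, Ne.symm hj]
      · simp [v, hzj]
      · simp [v, hνl]
    · intro r
      -- Only the form `b l` gets a nonzero gradient outside direction `j`; indices outside the
      -- range of `a` get the value zero.
      choose q hq hqv hqg using fun i : I => exists_form_with_gradient (he i) hzj
        (Function.extend a (fun k => r (Sum.inl k)) 0 i)
        (fun k => if i = b l then
          (if hk : ∃ m : Fin n, m.succ = k ∧ m.succ ≠ j then r (Sum.inr ⟨hk.choose, hk.choose_spec.2⟩)
            else 0) else 0)
      obtain ⟨c', hc'⟩ := exists_form_eq e q hq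
      refine ⟨c', ?_⟩
      ext (i | m)
      · simp [L, hc', hqv, ha.extend_apply, Function.comp_def]
      · simp only [L, LinearMap.coe_mk, AddHom.coe_mk, Sum.elim_inr, hc']
        change ∑ i, ν i * eval z (pderiv m.1.succ (q (b i))) = r (Sum.inr m)
        rw [Finset.sum_eq_single l]
        · rw [hνl, one_mul, hqg _ _ m.2, if_pos rfl]
          have hk : ∃ m' : Fin n, m'.succ = m.1.succ ∧ m'.succ ≠ j := ⟨m.1, rfl, m.2⟩
          rw [dif_pos hk]
          congr 2
          exact Subtype.ext (Fin.succ_injective _ hk.choose_spec.1)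
        · intro d _ hd
          rw [hqg _ _ m.2, if_neg fun h => hd (hb h), mul_zero]
        · simp
    · ext (i | m)
      · exact h1 i
      · exact h2 m.1 m.2

theorem thin_dependentLocus (he : ∀ i, 0 < e i) {a : Z → I} {b : D → I}
    (ha : Function.Injective a) (hb : Function.Injective b)
    (h : Fintype.card D ≤ Fintype.card Z) :
    Thin (dependentLocus e a b : Set ((Σ i, Expo n (e i)) → K)) := by
  refine (Thin.iUnion fun j => Thin.iUnion fun l =>
    thin_dependent_chart (n := n) (K := K) he ha hb h j l).mono ?_
  rintro c ⟨z, hz, ν, hν, h1, h2⟩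
  -- The chart `j = 0` is used whenever `z 0 ≠ 0`, so the other charts are needed only on the
  -- hyperplane at infinity.
  obtain ⟨j, hj, hj0⟩ : ∃ j, z j ≠ 0 ∧ (j ≠ 0 → z 0 = 0) := by
    by_cases h0 : z 0 = 0
    · obtain ⟨j, hj⟩ := Function.ne_iff.1 hz
      exact ⟨j, hj, fun _ => h0⟩
    · exact ⟨0, h0, fun h => (h rfl).elim⟩
  obtain ⟨l, hl⟩ := Function.ne_iff.1 hν
  simp only [Set.mem_iUnion]
  set s := (z j)⁻¹ with hs
  have hs0 : s ≠ 0 := inv_ne_zero hj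
  -- Scaling `z` by `s` multiplies the derivatives of the form `b i` by `s ^ (e (b i) - 1)`. The
  -- multipliers absorb these factors, up to a common one chosen to make the `l`-th multiplier `1`.
  refine ⟨j, l, s • z, by simp [hs, hj], fun h => by simp [hj0 h],
    fun i => (ν l)⁻¹ * s ^ e (b l) * ν i * (s ^ e (b i))⁻¹, ?_, fun i => ?_, fun m _ => ?_⟩
  · have : s ^ e (b l) ≠ 0 := pow_ne_zero _ hs0
    have hl' : ν l ≠ 0 := hl
    field_simp
  · rw [eval_smul_of_isHomogeneous (form_isHomogeneous _ _ _), h1, mul_zero]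
  · have h3 := congrArg (fun x => (ν l)⁻¹ * s ^ e (b l) * x) (h2 m)
    simp only [mul_zero, Finset.mul_sum] at h3
    rw [← mul_eq_zero_iff_left hs0, ← h3, Finset.mul_sum]
    refine Finset.sum_congr rfl fun i _ => ?_
    have h4 := eval_smul_pderiv_of_isHomogeneous (form_isHomogeneous e (b i) c) s z m.succ
    have h5 : s ^ e (b i) ≠ 0 := pow_ne_zero _ hs0
    rw [mul_left_comm, h4]
    field_simp


/-- The families of forms of which one, `o none`, has a critical point with `x₀ = 1` on the zero
set of the others at which the Hessian of the Lagrangian degenerates on the tangent space; the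
multiplier of the form `o l` is nonzero. -/
def hessianLocus {ι : Type*} [Fintype ι] (e : I → ℕ) (o : Option ι → I) (l : Option ι) :
    Set ((Σ i, Expo n (e i)) → K) :=
  {c | ∃ (z : Fin (n + 1) → K) (y : Fin n → K) (lam : Option ι → K) (mu : ι → K),
    z 0 = 1 ∧ y ≠ 0 ∧ lam none ≠ 0 ∧ lam l ≠ 0 ∧
    (∀ i, eval z (form e (o (some i)) c) = 0) ∧
    (∀ i, ∑ k : Fin n, eval z (pderiv k.succ (form e (o (some i)) c)) * y k = 0) ∧
    (∀ m : Fin n, ∑ i, lam i * eval z (pderiv m.succ (form e (o i) c)) = 0) ∧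
    ∀ m : Fin n, ∑ i, lam i *
      (∑ k : Fin n, eval z (pderiv k.succ (pderiv m.succ (form e (o i) c))) * y k) +
      ∑ i, mu i * eval z (pderiv m.succ (form e (o (some i)) c)) = 0}

/-- The system is triangular. The constraint forms get values `α` and gradients along the `p`-th
axis that realize `β`; the gradient of the form `none` then gives `γ`, as `lam none ≠ 0`; finally
the Hessian of the form `l`, of degree at least two, gives `δ` without disturbing values or
gradients. -/
theorem exists_forms_with_conditions {ι : Type*} [Fintype ι] [DecidableEq ι] (h2 : (2 : K) ≠ 0)
    {e' : Option ι → ℕ} (he : ∀ i, 0 < e' i) {l : Option ι} (hl : 2 ≤ e' l)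
    {z : Fin (n + 1) → K} {y : Fin n → K} {lam : Option ι → K} {mu : ι → K} {p : Fin n}
    (hz : z 0 = 1) (hy : y p = 1) (hlam : lam none ≠ 0) (hlaml : lam l = 1)
    (α β : ι → K) (γ δ : Fin n → K) :
    ∃ q : Option ι → MvPolynomial (Fin (n + 1)) K, (∀ i, (q i).IsHomogeneous (e' i)) ∧
      (∀ i, eval z (q (some i)) = α i) ∧
      (∀ i, ∑ k : Fin n, eval z (pderiv k.succ (q (some i))) * y k = β i) ∧
      (∀ m : Fin n, ∑ i, lam i * eval z (pderiv m.succ (q i)) = γ m) ∧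
      ∀ m : Fin n, ∑ i, lam i *
        (∑ k : Fin n, eval z (pderiv k.succ (pderiv m.succ (q i))) * y k) +
        ∑ i, mu i * eval z (pderiv m.succ (q (some i))) = δ m := by
  let V : Option ι → K := fun i => i.elim 0 α
  let G' : ι → Fin n → K := fun i k => if k = p then β i else 0
  let G : Option ι → Fin n → K := fun i =>
    i.elim (fun m => (lam none)⁻¹ * (γ m - ∑ i, lam (some i) * G' i m)) G'
  choose q hq hqV hqG using fun i => exists_form_with_gradient (he i) hz (V i) (Fin.cons 0 (G i))
  have hqG' : ∀ i (m : Fin n), eval z (pderiv m.succ (q i)) = G i m := fun i m => by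
    rw [hqG i _ (Fin.succ_ne_zero m), Fin.cons_succ]
  obtain ⟨Q, hQ, hQV, hQG, hQH⟩ := exists_form_with_hessian hl h2 hz hy (V l) (G l) fun m =>
    δ m - ∑ i ∈ Finset.univ.erase l, lam i *
      (∑ k : Fin n, eval z (pderiv k.succ (pderiv m.succ (q i))) * y k) - ∑ i, mu i * G' i m
  let q' := Function.update q l Q
  have hV : ∀ i, eval z (q' i) = V i := by
    intro i
    by_cases hi : i = l
    · subst hi; simp [q', hQV]
    · simp [q', hi, hqV]
  have hG : ∀ i (m : Fin n), eval z (pderiv m.succ (q' i)) = G i m := by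
    intro i m
    by_cases hi : i = l
    · subst hi; simp [q', hQG]
    · simp [q', hi, hqG']
  refine ⟨q', fun i => ?_, fun i => hV _, fun i => ?_, fun m => ?_, fun m => ?_⟩
  · by_cases hi : i = l
    · subst hi; simpa [q'] using hQ
    · simpa [q', hi] using hq i
  · simp [hG, G, G', hy]
  · simp only [hG, Fintype.sum_option]
    simp only [G, Option.elim_none, Option.elim_some]
    field_simp
    ring
  · rw [← Finset.add_sum_erase _ _ (Finset.mem_univ l)]
    have h3 : ∑ i ∈ Finset.univ.erase l, lam i *
        (∑ k : Fin n, eval z (pderiv k.succ (pderiv m.succ (q' i))) * y k) =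
        ∑ i ∈ Finset.univ.erase l, lam i *
        (∑ k : Fin n, eval z (pderiv k.succ (pderiv m.succ (q i))) * y k) := by
      refine Finset.sum_congr rfl fun i hi => ?_
      simp [q', Finset.ne_of_mem_erase hi]
    rw [h3]
    simp only [hG]
    simp only [q', Function.update_self, hlaml, one_mul, hQH, G, Option.elim_some]
    ring

/-- With `k` constraint forms there are `2 n + 2 k + 2` parameters `z, y, lam, mu`, of which three
are prescribed, and `2 n + 2 k` conditions, independent by `exists_forms_with_conditions`. -/
theorem thin_hessian_chart {ι : Type*} [Fintype ι] [DecidableEq ι] (h2 : (2 : K) ≠ 0)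
    (he : ∀ i, 0 < e i) {o : Option ι → I} (ho : Function.Injective o) {l : Option ι}
    (hl : 2 ≤ e (o l)) (p : Fin n) :
    Thin {c : (Σ i, Expo n (e i)) → K | ∃ (z : Fin (n + 1) → K) (y : Fin n → K)
      (lam : Option ι → K) (mu : ι → K),
      z 0 = 1 ∧ y p = 1 ∧ lam none ≠ 0 ∧ lam l = 1 ∧
      (∀ i, eval z (form e (o (some i)) c) = 0) ∧
      (∀ i, ∑ k : Fin n, eval z (pderiv k.succ (form e (o (some i)) c)) * y k = 0) ∧
      (∀ m : Fin n, ∑ i, lam i * eval z (pderiv m.succ (form e (o i) c)) = 0) ∧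
      ∀ m : Fin n, ∑ i, lam i *
        (∑ k : Fin n, eval z (pderiv k.succ (pderiv m.succ (form e (o i) c))) * y k) +
        ∑ i, mu i * eval z (pderiv m.succ (form e (o (some i)) c)) = 0} := by
  classical
  let B := (Fin (n + 1) ⊕ Fin n) ⊕ (Option ι ⊕ ι)
  let R := (ι ⊕ ι) ⊕ (Fin n ⊕ Fin n)
  let Tz : Fin (n + 1) → B := fun k => Sum.inl (Sum.inl k)
  let Ty : Fin n → B := fun k => Sum.inl (Sum.inr k)
  let Tl : Option ι → B := fun k => Sum.inr (Sum.inl k)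
  let Tm : ι → B := fun k => Sum.inr (Sum.inr k)
  let L : (B → K) → ((Σ i, Expo n (e i)) → K) →ₗ[K] (R → K) := fun t =>
    { toFun := fun c => Sum.elim
        (Sum.elim (fun i => eval (t ∘ Tz) (form e (o (some i)) c))
          fun i => ∑ k : Fin n, eval (t ∘ Tz) (pderiv k.succ (form e (o (some i)) c)) * t (Ty k))
        (Sum.elim (fun m => ∑ i, t (Tl i) * eval (t ∘ Tz) (pderiv m.succ (form e (o i) c)))
          fun m => ∑ i, t (Tl i) * (∑ k : Fin n,
            eval (t ∘ Tz) (pderiv k.succ (pderiv m.succ (form e (o i) c))) * t (Ty k)) +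
            ∑ i, t (Tm i) * eval (t ∘ Tz) (pderiv m.succ (form e (o (some i)) c)))
      map_add' := fun c c' => by
        ext ((i | i) | (m | m))
        · simp
        · simp [add_mul, Finset.sum_add_distrib]
        · simp only [map_add, mul_add, Finset.sum_add_distrib, Sum.elim_inr, Sum.elim_inl,
            Pi.add_apply]
        · simp only [map_add, mul_add, add_mul, Finset.sum_add_distrib, Sum.elim_inr,
            Pi.add_apply]
          ring
      map_smul' := fun s c => by
        ext ((i | i) | (m | m))
        · simp
        · simp [Finset.mul_sum, mul_assoc]
        · simp only [map_smul, Derivation.map_smul, smul_eval, Finset.mul_sum,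
            mul_left_comm (t _) s, Sum.elim_inr, Sum.elim_inl, Pi.smul_apply, smul_eq_mul,
              RingHom.id_apply]
        · simp only [map_smul, Derivation.map_smul, smul_eval, Finset.mul_sum,
            mul_left_comm (t _) s, mul_assoc, Sum.elim_inr, Pi.smul_apply, smul_eq_mul,
              RingHom.id_apply, mul_add] }
  let S : Finset B := {Tz 0, Ty p, Tl l}
  have hcard : Fintype.card B < Fintype.card R + S.card := by
    have : S.card = 3 := by
      simp only [S]
      rw [Finset.card_insert_of_notMem, Finset.card_pair]
      · exact Sum.inl_ne_inr
      · rw [Finset.mem_insert, Finset.mem_singleton, not_or]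
        exact ⟨fun h => Sum.inl_ne_inr (Sum.inl_injective h), Sum.inl_ne_inr⟩
    rw [this]
    simp only [B, R, Fintype.card_sum, Fintype.card_option, Fintype.card_fin]
    omega
  refine (thin_of_linear_conditions L ?_ S (fun _ => 1) hcard).mono ?_
  · rintro c ((i | i) | (m | m))
    · exact eval_form_mem_polyFun _ _
    · change (fun t : B → K => ∑ k : Fin n, eval (t ∘ Tz)
        (pderiv k.succ (form e (o (some i)) (Pi.single c 1))) * t (Ty k)) ∈ polyFun B K
      refine sum_mem_polyFun _ fun k _ => ?_
      exact (polyFun B K).mul_mem (eval_form_mem_polyFun _ _) (coord_mem_polyFun _)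
    · refine sum_mem_polyFun _ fun i _ => ?_
      exact (polyFun B K).mul_mem (coord_mem_polyFun _) (eval_form_mem_polyFun _ _)
    · refine (polyFun B K).add_mem (sum_mem_polyFun _ fun i _ => ?_)
        (sum_mem_polyFun _ fun i _ => ?_)
      · refine (polyFun B K).mul_mem (coord_mem_polyFun _) (sum_mem_polyFun _ fun k _ => ?_)
        exact (polyFun B K).mul_mem (eval_form_mem_polyFun _ _) (coord_mem_polyFun _)
      · exact (polyFun B K).mul_mem (coord_mem_polyFun _) (eval_form_mem_polyFun _ _)
  · rintro c ⟨z, y, lam, mu, hz, hy, hlam, hlaml, h1, h3, h4, h5⟩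
    refine ⟨Sum.elim (Sum.elim z y) (Sum.elim lam mu), ?_, ?_, ?_⟩
    · intro x hx
      simp only [S, Finset.mem_insert, Finset.mem_singleton] at hx
      rcases hx with rfl | rfl | rfl
      · exact hz
      · exact hy
      · exact hlaml
    · intro r
      obtain ⟨q, hq, q1, q2, q3, q4⟩ := exists_forms_with_conditions (mu := mu) h2
        (fun i => he (o i)) hl hz hy hlam hlaml (fun i => r (Sum.inl (Sum.inl i)))
        (fun i => r (Sum.inl (Sum.inr i))) (fun i => r (Sum.inr (Sum.inl i)))
        (fun i => r (Sum.inr (Sum.inr i)))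
      obtain ⟨c', hc'⟩ := exists_form_eq e (Function.extend o q 0) (by
        intro i
        by_cases hi : ∃ k, o k = i
        · obtain ⟨k, rfl⟩ := hi
          rw [ho.extend_apply]
          exact hq k
        · rw [Function.extend_apply' _ _ _ hi]
          exact isHomogeneous_zero _ _ _)
      have hc : ∀ i, form e (o i) c' = q i := fun i => by rw [hc', ho.extend_apply]
      refine ⟨c', ?_⟩
      ext ((i | i) | (m | m))
      · simp only [L, LinearMap.coe_mk, AddHom.coe_mk, Sum.elim_inl, hc]
        exact q1 i
      · simp only [L, LinearMap.coe_mk, AddHom.coe_mk, Sum.elim_inl, Sum.elim_inr, hc]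
        exact q2 i
      · simp only [L, LinearMap.coe_mk, AddHom.coe_mk, Sum.elim_inl, Sum.elim_inr, hc]
        exact q3 m
      · simp only [L, LinearMap.coe_mk, AddHom.coe_mk, Sum.elim_inr, hc]
        exact q4 m
    · ext ((i | i) | (m | m))
      · exact h1 i
      · exact h3 i
      · exact h4 m
      · exact h5 m

theorem thin_hessianLocus {ι : Type*} [Fintype ι] [DecidableEq ι] (h2 : (2 : K) ≠ 0)
    (he : ∀ i, 0 < e i) {o : Option ι → I} (ho : Function.Injective o) {l : Option ι}
    (hl : 2 ≤ e (o l)) :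
    Thin (hessianLocus e o l : Set ((Σ i, Expo n (e i)) → K)) := by
  refine (Thin.iUnion fun p => thin_hessian_chart (n := n) h2 he ho hl p).mono ?_
  rintro c ⟨z, y, lam, mu, hz, hy, hlam, hlaml, h1, h3, h4, h5⟩
  obtain ⟨p, hp⟩ := Function.ne_iff.1 hy
  rw [Pi.zero_apply] at hp
  refine Set.mem_iUnion.2 ⟨p, z, (y p)⁻¹ • y, (lam l)⁻¹ • lam, ((lam l)⁻¹ * (y p)⁻¹) • mu, hz,
    by simp [hp], by simp [hlam, hlaml], by simp [hlaml], h1, fun i => ?_, fun m => ?_, fun m => ?_⟩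
  · have := congrArg ((y p)⁻¹ * ·) (h3 i)
    simp only [Finset.mul_sum, mul_zero] at this
    rw [← this]
    refine Finset.sum_congr rfl fun k _ => ?_
    simp only [Pi.smul_apply, smul_eq_mul]
    ring
  · have := congrArg ((lam l)⁻¹ * ·) (h4 m)
    simp only [Finset.mul_sum, mul_zero] at this
    rw [← this]
    refine Finset.sum_congr rfl fun k _ => ?_
    simp only [Pi.smul_apply, smul_eq_mul]
    ring
  · have := congrArg ((lam l)⁻¹ * (y p)⁻¹ * ·) (h5 m)
    simp only [mul_add, Finset.mul_sum, mul_zero] at this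
    rw [← this]
    congr 1
    · refine Finset.sum_congr rfl fun i _ => ?_
      rw [Finset.mul_sum]
      refine Finset.sum_congr rfl fun k _ => ?_
      simp only [Pi.smul_apply, smul_eq_mul]
      ring
    · refine Finset.sum_congr rfl fun i _ => ?_
      simp only [Pi.smul_apply, smul_eq_mul]
      ring

end Dependent

/-! ### The degenerate loci lie in thin sets -/

section Loci

variable {n : ℕ} {I : Type*} {e : I → ℕ}

theorem aeval_form (i : I) (c : (Σ i, Expo n (e i)) → ℝ) (z : Fin (n + 1) → ℂ) :
    aeval z (form e i c) = eval z (form e i fun p => (c p : ℂ)) := by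
  rw [aeval_def, eval₂_eq_eval_map, map_form]
  rfl

theorem cderiv_form (i : I) (c : (Σ i, Expo n (e i)) → ℝ) (z : Fin (n + 1) → ℂ)
    (j : Fin (n + 1)) :
    cderiv (form e i c) z j = eval z (pderiv j (form e i fun p => (c p : ℂ))) := by
  rw [cderiv, aeval_def, eval₂_eq_eval_map, ← pderiv_map, map_form]
  rfl

theorem cderiv_pderiv_form (i : I) (c : (Σ i, Expo n (e i)) → ℝ) (z : Fin (n + 1) → ℂ)
    (j k : Fin (n + 1)) :
    cderiv (pderiv k (form e i c)) z j =
      eval z (pderiv j (pderiv k (form e i fun p => (c p : ℂ)))) := by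
  rw [cderiv, aeval_def, eval₂_eq_eval_map, ← pderiv_map, ← pderiv_map, map_form]
  rfl

theorem sum_mul_eval_pderiv {σ K : Type*} [CommRing K] [Fintype σ] {q : MvPolynomial σ K} {e : ℕ}
    (hq : q.IsHomogeneous e) (z : σ → K) :
    ∑ j, z j * eval z (pderiv j q) = e * eval z q := by
  have := congrArg (eval z) hq.sum_X_mul_pderiv
  simpa using this

variable {ι : Type} [Fintype ι] {o : ι → I} {c : (Σ i, Expo n (e i)) → ℝ}

/-- More than `n` vectors of length `n` are dependent, so the resultant locus is a special case of
the dependent locus. -/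
theorem mem_dependentLocus_of_hasCommonZero (hn : n < Fintype.card ι)
    (h : HasCommonZero fun i => form e (o i) c) :
    (fun p => (c p : ℂ)) ∈ dependentLocus e o o := by
  classical
  obtain ⟨z, hz, h⟩ := h
  let A : Matrix (Fin n) ι ℂ :=
    Matrix.of fun m i => eval z (pderiv m.succ (form e (o i) fun p => (c p : ℂ)))
  obtain ⟨ν, hν, hA⟩ := (rank_lt_card_iff_exists_mulVec_eq_zero A).1
    (lt_of_le_of_lt A.rank_le_card_height (by simpa using hn))
  refine ⟨z, hz, ν, hν, fun i => ?_, fun m => ?_⟩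
  · rw [← aeval_form]
    exact h i
  · simpa [A, Matrix.mulVec, dotProduct, mul_comm] using congrFun hA m

theorem mem_dependentLocus_of_hasSingularZero (h : HasSingularZero fun i => form e (o i) c) :
    (fun p => (c p : ℂ)) ∈ dependentLocus e o o := by
  classical
  obtain ⟨z, hz, h, hr⟩ := h
  obtain ⟨ν, hν, hA⟩ := (rank_lt_card_iff_exists_mulVec_eq_zero _).1 hr
  refine ⟨z, hz, ν, hν, fun i => ?_, fun m => ?_⟩
  · rw [← aeval_form]
    exact h i
  · simpa [Matrix.mulVec, dotProduct, mul_comm, cderiv_form] using congrFun hA m.succ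

theorem form_option_elim {ι : Type} (f : I) (o : ι → I) (i : Option ι)
    (c : (Σ i, Expo n (e i)) → ℝ) :
    i.elim (form e f c) (fun i => form e (o i) c) = form e (i.elim f o) c := by
  cases i <;> rfl

/-- Exchanging the form `q` for `f` keeps the number of gradients equal to the number of vanishing
forms, as the dimension count requires. -/
theorem mem_dependentLocus_of_kktMeets [DecidableEq ι] {f : I} {q : ι}
    (h : KKTMeets (form e f c) (fun i : {i // i ≠ q} => form e (o i) c) (form e (o q) c)) :
    (fun p => (c p : ℂ)) ∈ dependentLocus e o
      fun i : Option {i // i ≠ q} => i.elim f fun i => o i := by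
  obtain ⟨z, hz, hr, h1, h2⟩ := h
  rw [← Nat.lt_succ_iff, Nat.succ_eq_add_one, ← Fintype.card_option] at hr
  obtain ⟨ν, hν, hA⟩ := (rank_lt_card_iff_exists_mulVec_eq_zero _).1 hr
  refine ⟨z, hz, ν, hν, fun i => ?_, fun m => ?_⟩
  · rw [← aeval_form]
    by_cases hi : i = q
    · rw [hi]; exact h2
    · exact h1 ⟨i, hi⟩
  · have := congrFun hA m
    simp only [form_option_elim (e := e) f (fun i : {i // i ≠ q} => o i), xgrad, cderiv_form] at this
    refine Eq.trans ?_ this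
    simp [Matrix.mulVec, dotProduct, mul_comm]

/-- A kernel vector `(lam, mu)` of the block matrix puts the coefficients in `hessianLocus` if `lam
none ≠ 0`, `z 0 ≠ 0` and some form of degree at least two has a nonzero multiplier. In each
exceptional case some gradients turn out to be dependent at a common zero of sufficiently many
forms. -/
theorem mem_locus_of_kktSingular (he : ∀ i, 0 < e i) {f : I} (hn : Fintype.card ι ≤ n)
    (h : KKTSingular (form e f c) fun i => form e (o i) c) :
    (fun p => (c p : ℂ)) ∈ dependentLocus e o o ∪ dependentLocus e (fun i : Option ι => i.elim f o)
      (fun i : Option ι => i.elim f o) ∪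
      dependentLocus e (fun i : {i : Option ι // e (i.elim f o) = 1} => i.1.elim f o)
      (fun i : {i : Option ι // e (i.elim f o) = 1} => i.1.elim f o) ∪
      ⋃ l : {l : Option ι // 2 ≤ e (l.elim f o)},
        hessianLocus e (fun i : Option ι => i.elim f o) l.1 := by
  classical
  obtain ⟨z, y, hz, hy, hr, h1, h2⟩ := h
  have hr' : (hessMatrix (form e f c) (fun i => form e (o i) c) z y).rank <
      Fintype.card (Option ι ⊕ ι) := by
    rw [Fintype.card_sum, Fintype.card_option]
    omega
  obtain ⟨ν, hν, hA⟩ := (rank_lt_card_iff_exists_mulVec_eq_zero _).1 hr'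
  set lam : Option ι → ℂ := fun i => ν (Sum.inl i)
  set mu : ι → ℂ := fun i => ν (Sum.inr i)
  set q : Option ι → MvPolynomial (Fin (n + 1)) ℂ := fun i =>
    form e (i.elim f o) fun p => (c p : ℂ) with hq
  have hqh : ∀ i, (q i).IsHomogeneous (e (i.elim f o)) := fun i => form_isHomogeneous _ _ _
  have hq1 : ∀ i, eval z (q (some i)) = 0 := fun i => by
    rw [← h1 i, aeval_form]; rfl
  have hq2 : ∀ i, ∑ k : Fin n, eval z (pderiv k.succ (q (some i))) * y k = 0 := fun i => by
    rw [← h2 i]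
    simp only [dotProduct, xgrad, cderiv_form]
    rfl
  have hA1 : ∀ m : Fin n, ∑ i, lam i * eval z (pderiv m.succ (q i)) = 0 := by
    intro m
    have := congrFun hA (Sum.inl m)
    simp only [hessMatrix, form_option_elim, xgrad, cderiv_form] at this
    refine Eq.trans ?_ this
    simp [Matrix.mulVec, dotProduct, mul_comm, lam, hq]
  have hA2 : ∀ m : Fin n, ∑ i, lam i *
      (∑ k : Fin n, eval z (pderiv k.succ (pderiv m.succ (q i))) * y k) +
      ∑ i, mu i * eval z (pderiv m.succ (q (some i))) = 0 := by
    intro m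
    have := congrFun hA (Sum.inr m)
    simp only [hessMatrix, form_option_elim, xgrad, xhess, cderiv_form, cderiv_pderiv_form] at this
    refine Eq.trans ?_ this
    simp [Matrix.mulVec, dotProduct, mul_comm, lam, hq, mu]
  -- Without the objective, either `lam` or, if `lam = 0`, the vector `mu` is a dependence among the
  -- constraint gradients.
  by_cases hl0 : lam none = 0
  · left; left; left
    have hq1' : ∀ i, eval z (form e (o i) fun p => (c p : ℂ)) = 0 := hq1
    by_cases hl : lam = 0
    · refine ⟨z, hz, mu, ?_, hq1', fun m => ?_⟩
      · intro h
        exact hν (funext fun x => by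
          rcases x with i | i
          · exact congrFun hl i
          · exact congrFun h i)
      · have := hA2 m
        simp only [hl, Pi.zero_apply, zero_mul, Finset.sum_const_zero, zero_add] at this
        exact this
    · refine ⟨z, hz, fun i => lam (some i), fun h => hl ?_, hq1', fun m => ?_⟩
      · funext i
        cases i with
        | none => exact hl0
        | some i => exact congrFun h i
      · have := hA1 m
        rwa [Fintype.sum_option, hl0, zero_mul, zero_add] at this
  -- At infinity Euler's formula involves only the `x`-derivatives. The dependence with weights
  -- `lam` then forces the objective to vanish at `z` too, so it joins the vanishing forms.
  by_cases hz0 : z 0 = 0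
  · left; left; right
    refine ⟨z, hz, lam, fun h => hl0 (congrFun h none), fun i => ?_, hA1⟩
    have hE : ∀ i, ∑ m : Fin n, z m.succ * eval z (pderiv m.succ (q i)) =
        e (i.elim f o) * eval z (q i) := by
      intro i
      rw [← sum_mul_eval_pderiv (hqh i), Fin.sum_univ_succ, hz0, zero_mul, zero_add]
    cases i with
    | some i => exact hq1 i
    | none =>
      have h3 : ∑ i, lam i * (e (i.elim f o) * eval z (q i)) = 0 := by
        simp_rw [← hE, Finset.mul_sum]
        rw [Finset.sum_comm]
        refine Finset.sum_eq_zero fun m _ => ?_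
        simp_rw [mul_left_comm, ← Finset.mul_sum, hA1, mul_zero]
      rw [Fintype.sum_option] at h3
      simp only [hq1, mul_zero, Finset.sum_const_zero, add_zero, mul_eq_zero, hl0, false_or,
        Nat.cast_eq_zero] at h3
      exact h3.resolve_left (he _).ne'
  -- With `n` constraints, `y` is a nonzero vector orthogonal to `n` gradients in dimension `n`, so
  -- these are dependent.
  rcases hn.eq_or_lt with hn | hn
  · left; left; left
    let A : Matrix ι (Fin n) ℂ := Matrix.of fun i k => eval z (pderiv k.succ (q (some i)))
    have hA : A.rank < Fintype.card ι := by
      rw [hn]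
      conv_rhs => rw [← Fintype.card_fin n]
      exact (rank_lt_card_iff_exists_mulVec_eq_zero A).2 ⟨y, hy, funext hq2⟩
    rw [← Matrix.rank_transpose] at hA
    obtain ⟨ν', hν', hA'⟩ := (rank_lt_card_iff_exists_mulVec_eq_zero _).1 hA
    refine ⟨z, hz, ν', hν', hq1, fun m => Eq.trans ?_ (congrFun hA' m)⟩
    simp [Matrix.mulVec, dotProduct, A, mul_comm, hq]
  by_cases hl : ∃ l, lam l ≠ 0 ∧ 2 ≤ e (l.elim f o)
  · right
    obtain ⟨l, hl, hle⟩ := hl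
    refine Set.mem_iUnion.2 ⟨⟨l, hle⟩, ?_⟩
    set s := (z 0)⁻¹ with hs
    have hs0 : s ≠ 0 := inv_ne_zero hz0
    have hse : ∀ k : ℕ, s ^ k ≠ 0 := fun k => pow_ne_zero _ hs0
    have hd1 : ∀ i m, eval (s • z) (pderiv m (q i)) =
        s⁻¹ * (s ^ e (i.elim f o) * eval z (pderiv m (q i))) := by
      intro i m
      rw [← eval_smul_pderiv_of_isHomogeneous (hqh i), inv_mul_cancel_left₀ hs0]
    have hd2 : ∀ i k m, eval (s • z) (pderiv k (pderiv m (q i))) =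
        s⁻¹ * (s⁻¹ * (s ^ e (i.elim f o) * eval z (pderiv k (pderiv m (q i))))) := by
      intro i k m
      have h3 := eval_smul_pderiv_of_isHomogeneous ((hqh i).pderiv (i := m)) s z k
      have h4 : s ^ e (i.elim f o) = s * s ^ (e (i.elim f o) - 1) := by
        rw [← pow_succ', Nat.sub_add_cancel (he _)]
      rw [h4, mul_assoc, ← h3, inv_mul_cancel_left₀ hs0, inv_mul_cancel_left₀ hs0]
    -- Normalizing `z 0 = 1` scales first derivatives by `s ^ (e - 1)` and second derivatives by `s
    -- ^ (e - 2)`; the extra `s⁻¹` in the new `mu` accounts for the difference.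
    refine ⟨s • z, y, fun i => lam i * (s ^ e (i.elim f o))⁻¹,
      fun i => mu i * s⁻¹ * (s ^ e (o i))⁻¹, by simp [hs, hz0], hy, mul_ne_zero hl0
      (inv_ne_zero (hse _)), mul_ne_zero hl (inv_ne_zero (hse _)), fun i => ?_, fun i => ?_,
      fun m => ?_, fun m => ?_⟩
    · change eval (s • z) (q (some i)) = 0
      rw [eval_smul_of_isHomogeneous (hqh _), hq1, mul_zero]
    · change ∑ k : Fin n, eval (s • z) (pderiv k.succ (q (some i))) * y k = 0
      simp_rw [hd1, mul_assoc, ← Finset.mul_sum, hq2, mul_zero]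
    · change ∑ i, lam i * (s ^ e (i.elim f o))⁻¹ * eval (s • z) (pderiv m.succ (q i)) = 0
      rw [← mul_zero s⁻¹, ← hA1 m, Finset.mul_sum]
      refine Finset.sum_congr rfl fun i _ => ?_
      rw [hd1]
      field_simp [hse (e (i.elim f o))]
    · change ∑ i, lam i * (s ^ e (i.elim f o))⁻¹ *
        (∑ k : Fin n, eval (s • z) (pderiv k.succ (pderiv m.succ (q i))) * y k) +
        ∑ i, mu i * s⁻¹ * (s ^ e (o i))⁻¹ * eval (s • z) (pderiv m.succ (q (some i))) = 0
      rw [← mul_zero (s⁻¹ * s⁻¹), ← hA2 m, mul_add, Finset.mul_sum, Finset.mul_sum]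
      congr 1
      · refine Finset.sum_congr rfl fun i _ => ?_
        simp_rw [hd2, mul_assoc, ← Finset.mul_sum]
        field_simp [hse (e (i.elim f o))]
      · refine Finset.sum_congr rfl fun i _ => ?_
        rw [hd1]
        have := hse (e (o i))
        change _ * (s⁻¹ * (s ^ e (o i) * _)) = _
        field_simp
  -- All forms with nonzero multiplier are linear. There are at most `|ι| + 1 < n + 1` linear forms,
  -- so they have a common nonzero zero `z'`; their gradients are constant, so the dependence at `z`
  -- persists at `z'`.
  · left; right
    push Not at hl
    have hl1 : ∀ i, lam i ≠ 0 → e (i.elim f o) = 1 := fun i hi => by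
      have := hl i hi
      have := he (i.elim f o)
      omega
    let D := {i : Option ι // e (i.elim f o) = 1}
    let A : Matrix D (Fin (n + 1)) ℂ := Matrix.of fun i k => eval z (pderiv k (q i.1))
    have hA : A.rank < Fintype.card (Fin (n + 1)) := by
      refine lt_of_le_of_lt A.rank_le_card_height (lt_of_le_of_lt (Fintype.card_subtype_le _) ?_)
      rw [Fintype.card_option, Fintype.card_fin]
      omega
    obtain ⟨z', hz', hA'⟩ := (rank_lt_card_iff_exists_mulVec_eq_zero _).1 hA
    have hconst : ∀ (i : D) k, eval z' (pderiv k (q i.1)) = eval z (pderiv k (q i.1)) := by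
      intro i k
      have := (hqh i.1).pderiv (i := k)
      rw [i.2, ← totalDegree_zero_iff_isHomogeneous, totalDegree_eq_zero_iff_eq_C] at this
      rw [this, eval_C, eval_C]
    refine ⟨z', hz', fun i => lam i.1, fun h => hl0 (congrFun h ⟨none, hl1 none hl0⟩),
      fun i => ?_, fun m => ?_⟩
    · change eval z' (q i.1) = 0
      have h3 := sum_mul_eval_pderiv (hqh i.1) z'
      rw [i.2, Nat.cast_one, one_mul] at h3
      rw [← h3, ← Pi.zero_apply (M := fun _ : D => ℂ) i, ← hA']
      simp_rw [hconst]
      simp [Matrix.mulVec, dotProduct, A, mul_comm]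
    · change ∑ i : D, lam i.1 * eval z' (pderiv m.succ (q i.1)) = 0
      simp_rw [hconst]
      rw [← hA1 m, ← Fintype.sum_subtype_add_sum_subtype (fun i => e (i.elim f o) = 1)
        fun i => lam i * eval z (pderiv m.succ (q i))]
      have h3 : ∑ i : {i : Option ι // ¬ e (i.elim f o) = 1},
          lam i.1 * eval z (pderiv m.succ (q i.1)) = 0 := by
        refine Finset.sum_eq_zero fun i _ => ?_
        rw [not_imp_comm.1 (hl1 i.1) i.2, zero_mul]
      rw [h3, add_zero]

end Loci

/-! ### Elimination of projective and biprojective variables -/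

section Projective

variable {κ σ σ' C : Type*} [Finite σ] [Finite σ'] [Finite C]

/-- Specialization of the coefficients to real values. -/
def specialize {τ C : Type*} (c : C → ℝ) :
    MvPolynomial τ (MvPolynomial C ℤ) →+* MvPolynomial τ ℂ :=
  MvPolynomial.map (aeval fun i => (c i : ℂ) : MvPolynomial C ℤ →ₐ[ℤ] ℂ).toRingHom

/-- Here `E` consists of the variables, one of which is nonzero at `z` exactly when `z ≠ 0`. Degrees
are integers so that a derivative can be given degree `e - 1` without truncation. -/
theorem exists_polynomial_eliminating_projective (F : κ → MvPolynomial σ (MvPolynomial C ℤ))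
    (D : κ → ℤ) (hF : ∀ k, IsWeightedHomogeneous (fun _ => (1 : ℤ)) (F k) (D k)) :
    ∃ φ : MvPolynomial C ℤ, ∀ c : C → ℝ, aeval c φ = 0 ↔
      ∃ z : σ → ℂ, z ≠ 0 ∧ ∀ k, eval z (specialize c (F k)) = 0 := by
  have := Fintype.ofFinite σ
  have hw : ∀ b : σ →₀ ℕ, Finsupp.weight (fun _ => (1 : ℤ)) b = b.degree := by
    intro b
    simp [Finsupp.weight_apply, Finsupp.sum_fintype, Finsupp.degree_eq_sum]
  refine (exists_polynomial_eliminating (fun _ : σ => (1 : ℤ)) 1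
    (Set.range fun i => Finsupp.single i 1) ?_ ?_ ?_ ?_ F D hF).imp fun φ hφ c => (hφ c).trans ?_
  · rintro _ ⟨i, rfl⟩
    rw [hw, Finsupp.degree_single, Nat.cast_one]
  · intro N b hb
    rw [hw] at hb
    have hb0 : b ≠ 0 := by
      rintro rfl
      simp at hb
      omega
    obtain ⟨i, hi⟩ := Finsupp.ne_iff.1 hb0
    have hb' : b = Finsupp.single i 1 + (b - Finsupp.single i 1) := by
      rw [add_tsub_cancel_of_le]
      rw [Finsupp.single_le_iff]
      exact Nat.one_le_iff_ne_zero.2 hi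
    refine ⟨_, ⟨i, rfl⟩, _, ?_, hb'⟩
    rw [hb', map_add, Finsupp.degree_single] at hb
    rw [hw]
    simp at hb ⊢
    omega
  · intro b hb
    rw [hw] at hb
    exact (Finsupp.degree_eq_zero_iff b).1 (by exact_mod_cast hb)
  · intro N
    refine ((Finsupp.finite_of_degree_le (σ := σ) N).subset fun b hb => ?_).to_subtype
    have : Finsupp.weight (fun _ => (1 : ℤ)) b = N • 1 := hb
    rw [hw] at this
    simp at this
    exact this.le
  · have hX : ∀ (z : σ → ℂ) i, eval z (monomial (Finsupp.single i 1) (1 : ℂ)) = z i :=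
      fun z i => eval_X i
    simp only [Set.mem_range, exists_exists_eq_and, hX, Function.ne_iff, Pi.zero_apply]
    rfl

/-- The weights of the bigrading. -/
def biweight (σ σ' : Type*) : σ ⊕ σ' → ℤ × ℤ := Sum.elim (fun _ => (1, 0)) fun _ => (0, 1)

/-- Here `E` consists of the products of a variable of each group, of bidegree `(1, 1)`; one of them
is nonzero exactly when both `z` and `y` are. -/
theorem exists_polynomial_eliminating_biprojective
    (F : κ → MvPolynomial (σ ⊕ σ') (MvPolynomial C ℤ))
    (D : κ → ℤ × ℤ) (hF : ∀ k, IsWeightedHomogeneous (biweight σ σ') (F k) (D k)) :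
    ∃ φ : MvPolynomial C ℤ, ∀ c : C → ℝ, aeval c φ = 0 ↔
      ∃ (z : σ → ℂ) (y : σ' → ℂ), z ≠ 0 ∧ y ≠ 0 ∧
        ∀ k, eval (Sum.elim z y) (specialize c (F k)) = 0 := by
  classical
  have := Fintype.ofFinite σ
  have := Fintype.ofFinite σ'
  have hw : ∀ b : σ ⊕ σ' →₀ ℕ, Finsupp.weight (biweight σ σ') b =
      (((∑ i, b (Sum.inl i) : ℕ) : ℤ), ((∑ i, b (Sum.inr i) : ℕ) : ℤ)) := by
    intro b
    rw [Finsupp.weight_apply, Finsupp.sum_fintype _ _ (by simp), Fintype.sum_sum_type]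
    ext <;> simp [biweight, Prod.fst_sum, Prod.snd_sum]
  refine (exists_polynomial_eliminating (biweight σ σ') (1, 1)
    (Set.range fun p : σ × σ' => Finsupp.single (Sum.inl p.1) 1 + Finsupp.single (Sum.inr p.2) 1)
    ?_ ?_ ?_ ?_ F D hF).imp fun φ hφ c => (hφ c).trans ?_
  · rintro _ ⟨p, rfl⟩
    rw [map_add, Finsupp.weight_single, Finsupp.weight_single]
    simp [biweight]
  · intro N b hb
    rw [hw, Prod.ext_iff] at hb
    simp only [Prod.smul_mk, nsmul_eq_mul, mul_one] at hb
    norm_cast at hb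
    obtain ⟨i, hi⟩ : ∃ i, b (Sum.inl i) ≠ 0 := by
      by_contra! h
      simp [h] at hb
    obtain ⟨j, hj⟩ : ∃ j, b (Sum.inr j) ≠ 0 := by
      by_contra! h
      simp [h] at hb
    have hle : Finsupp.single (Sum.inl i) 1 + Finsupp.single (Sum.inr j) 1 ≤ b := by
      intro x
      rcases x with x | x
      · by_cases h : i = x
        · subst h; simp; omega
        · simp [h]
      · by_cases h : j = x
        · subst h; simp; omega
        · simp [h]
    refine ⟨_, ⟨(i, j), rfl⟩, _, ?_, (add_tsub_cancel_of_le hle).symm⟩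
    have h1 := congrArg (Finsupp.weight (biweight σ σ')) (add_tsub_cancel_of_le hle)
    rw [map_add, map_add, Finsupp.weight_single, Finsupp.weight_single, hw b, hb.1, hb.2] at h1
    rw [Prod.ext_iff] at h1 ⊢
    simp [biweight] at h1 ⊢
    omega
  · intro b hb
    rw [hw, Prod.ext_iff] at hb
    simp only [Prod.fst_zero, Prod.snd_zero, Nat.cast_eq_zero, Finset.sum_eq_zero_iff,
      Finset.mem_univ, true_imp_iff] at hb
    ext (x | x)
    · exact hb.1 x
    · exact hb.2 x
  · intro N
    refine ((Finsupp.finite_of_degree_le (σ := σ ⊕ σ') (N + N)).subset fun b hb => ?_).to_subtype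
    have h1 : Finsupp.weight (biweight σ σ') b = N • (1, 1) := hb
    rw [hw, Prod.ext_iff] at h1
    simp only [Prod.smul_mk, nsmul_eq_mul, mul_one, Nat.cast_inj] at h1
    change b.degree ≤ N + N
    rw [Finsupp.degree_eq_sum, Fintype.sum_sum_type, h1.1, h1.2]
  · have hX : ∀ (z : σ ⊕ σ' → ℂ) i, eval z (monomial (Finsupp.single i 1) (1 : ℂ)) = z i :=
      fun z i => eval_X i
    constructor
    · rintro ⟨z, ⟨_, ⟨p, rfl⟩, hp⟩, h⟩
      rw [← mul_one (1 : ℂ), ← monomial_mul, map_mul, hX, hX, mul_ne_zero_iff] at hp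
      refine ⟨z ∘ Sum.inl, z ∘ Sum.inr, fun h0 => hp.1 (congrFun h0 p.1),
        fun h0 => hp.2 (congrFun h0 p.2), ?_⟩
      rw [Sum.elim_comp_inl_inr]
      exact h
    · rintro ⟨z, y, hz, hy, h⟩
      obtain ⟨i, hi⟩ := Function.ne_iff.1 hz
      obtain ⟨j, hj⟩ := Function.ne_iff.1 hy
      refine ⟨Sum.elim z y, ⟨_, ⟨(i, j), rfl⟩, ?_⟩, h⟩
      rw [← mul_one (1 : ℂ), ← monomial_mul, map_mul, hX, hX]
      exact mul_ne_zero hi hj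

end Projective

/-- When the degrees of the entries split into a row part and a column part, every term of the
Leibniz expansion has the same degree. -/
theorem isWeightedHomogeneous_det {τ R M ι : Type*} [CommRing R] [AddCommMonoid M] [Fintype ι]
    [DecidableEq ι] {w : τ → M} {A : Matrix ι ι (MvPolynomial τ R)} {r s : ι → M}
    (hA : ∀ i j, IsWeightedHomogeneous w (A i j) (r i + s j)) :
    IsWeightedHomogeneous w A.det (∑ i, r i + ∑ i, s i) := by
  rw [Matrix.det_apply]
  refine IsWeightedHomogeneous.sum _ _ _ fun g _ => ?_
  have h := IsWeightedHomogeneous.prod Finset.univ (fun i => A (g i) i) (fun i => r (g i) + s i)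
    fun i _ => hA _ _
  rw [Finset.sum_add_distrib, Equiv.sum_comp g r] at h
  rcases Int.units_eq_one_or (Equiv.Perm.sign g) with h1 | h1
  · rwa [h1, one_smul]
  · rw [h1, Units.neg_smul, one_smul]
    exact h.neg

/-! ### Defining polynomials of the loci, from forms with indeterminate coefficients -/

section Universal

variable {n : ℕ} {I : Type*} {e : I → ℕ}

/-- The form of index `i` with indeterminate coefficients. -/
def universalForm (e : I → ℕ) (i : I) :
    MvPolynomial (Fin (n + 1)) (MvPolynomial (Σ i, Expo n (e i)) ℤ) := form e i X

theorem specialize_universalForm (i : I) (c : (Σ i, Expo n (e i)) → ℝ) :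
    specialize c (universalForm e i) = form e i fun p => (c p : ℂ) := by
  rw [specialize, universalForm, map_form]
  congr 1
  funext p
  simp

theorem specialize_pderiv {τ C : Type*} (c : C → ℝ) (j : τ)
    (p : MvPolynomial τ (MvPolynomial C ℤ)) :
    specialize c (pderiv j p) = pderiv j (specialize c p) := pderiv_map.symm

theorem specialize_rename {τ τ' C : Type*} (c : C → ℝ) (g : τ → τ')
    (p : MvPolynomial τ (MvPolynomial C ℤ)) :
    specialize c (rename g p) = rename g (specialize c p) := map_rename _ _ _

theorem eval_specialize_det {τ C ι : Type*} [Fintype ι] [DecidableEq ι] (c : C → ℝ) (z : τ → ℂ)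
    (A : Matrix ι ι (MvPolynomial τ (MvPolynomial C ℤ))) :
    eval z (specialize c A.det) = (A.map fun p => eval z (specialize c p)).det := by
  rw [RingHom.map_det, RingHom.map_det]
  rfl

theorem isWeightedHomogeneous_universalForm (i : I) :
    IsWeightedHomogeneous (fun _ => (1 : ℤ)) (universalForm (n := n) e i) (e i) := by
  intro b hb
  have := form_isHomogeneous e i X hb
  rw [Finsupp.weight_apply, Finsupp.sum] at this ⊢
  rw [← this]
  simp

theorem isWeightedHomogeneous_pderiv_universalForm (i : I) (j : Fin (n + 1)) :
    IsWeightedHomogeneous (fun _ => (1 : ℤ)) (pderiv j (universalForm (n := n) e i)) (e i - 1) :=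
  (isWeightedHomogeneous_universalForm i).pderiv (by simp)

theorem isWeightedHomogeneous_rename_inl {R σ σ' : Type*} [CommRing R] {p : MvPolynomial σ R}
    {a : ℤ} (h : IsWeightedHomogeneous (fun _ => (1 : ℤ)) p a) :
    IsWeightedHomogeneous (biweight σ σ') (rename Sum.inl p) (a, 0) := by
  classical
  intro b hb
  obtain ⟨u, rfl, hu⟩ := coeff_rename_ne_zero _ _ _ hb
  rw [← h hu, Finsupp.weight_apply, Finsupp.weight_apply, Finsupp.sum_mapDomain_index (by simp)
    (by simp [add_mul])]
  simp [biweight, Finsupp.sum, Prod.ext_iff, Prod.fst_sum, Prod.snd_sum]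

variable [Finite I] {ι : Type} [Fintype ι] [DecidableEq ι]

omit [Fintype ι] [DecidableEq ι] in
theorem exists_polynomial_hasCommonZero (e : I → ℕ) (o : ι → I) :
    ∃ φ : MvPolynomial (Σ i, Expo n (e i)) ℤ, ∀ c : (Σ i, Expo n (e i)) → ℝ,
      aeval c φ = 0 ↔ HasCommonZero fun i => form e (o i) c := by
  obtain ⟨φ, hφ⟩ := exists_polynomial_eliminating_projective
    (fun i => universalForm (n := n) e (o i)) (fun i => (e (o i) : ℤ))
    fun i => isWeightedHomogeneous_universalForm _
  refine ⟨φ, fun c => (hφ c).trans ?_⟩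
  simp only [specialize_universalForm, HasCommonZero, aeval_form]

theorem exists_polynomial_hasSingularZero (e : I → ℕ) (o : ι → I) :
    ∃ φ : MvPolynomial (Σ i, Expo n (e i)) ℤ, ∀ c : (Σ i, Expo n (e i)) → ℝ,
      aeval c φ = 0 ↔ HasSingularZero fun i => form e (o i) c := by
  obtain ⟨φ, hφ⟩ := exists_polynomial_eliminating_projective (σ := Fin (n + 1))
    (Sum.elim (fun i => universalForm (n := n) e (o i)) fun s : ι → Fin (n + 1) =>
      (Matrix.of fun a b => pderiv (s a) (universalForm e (o b))).det)
    (Sum.elim (fun i => (e (o i) : ℤ)) fun _ => ∑ _i : ι, 0 + ∑ i, ((e (o i) : ℤ) - 1)) (by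
      rintro (i | s)
      · exact isWeightedHomogeneous_universalForm _
      · refine isWeightedHomogeneous_det fun a b => ?_
        rw [zero_add]
        exact isWeightedHomogeneous_pderiv_universalForm _ _)
  refine ⟨φ, fun c => (hφ c).trans ?_⟩
  simp only [HasSingularZero, rank_lt_card_iff_forall_det_eq_zero, Sum.forall, Sum.elim_inl,
    Sum.elim_inr, specialize_universalForm, aeval_form, eval_specialize_det, cderiv_form]
  refine exists_congr fun z => and_congr_right fun _ => and_congr_right fun _ =>
    forall_congr' fun s => ?_
  rw [iff_iff_eq]
  congr 2
  ext a b
  simp [specialize_pderiv, specialize_universalForm]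

theorem exists_polynomial_kktMeets (e : I → ℕ) (f : I) (o : ι → I) (q : ι) :
    ∃ φ : MvPolynomial (Σ i, Expo n (e i)) ℤ, ∀ c : (Σ i, Expo n (e i)) → ℝ,
      aeval c φ = 0 ↔
        KKTMeets (form e f c) (fun i : {i // i ≠ q} => form e (o i) c) (form e (o q) c) := by
  let o' : Option {i // i ≠ q} → I := fun i => i.elim f fun i => o i
  obtain ⟨φ, hφ⟩ := exists_polynomial_eliminating_projective (σ := Fin (n + 1))
    (Sum.elim (fun i => universalForm (n := n) e (o i)) fun s : Option {i // i ≠ q} → Fin n =>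
      (Matrix.of fun a b => pderiv (s a).succ (universalForm e (o' b))).det)
    (Sum.elim (fun i => (e (o i) : ℤ)) fun _ =>
      ∑ _i : Option {i // i ≠ q}, 0 + ∑ i, ((e (o' i) : ℤ) - 1)) (by
      rintro (i | s)
      · exact isWeightedHomogeneous_universalForm _
      · refine isWeightedHomogeneous_det fun a b => ?_
        rw [zero_add]
        exact isWeightedHomogeneous_pderiv_universalForm _ _)
  refine ⟨φ, fun c => (hφ c).trans ?_⟩
  simp only [KKTMeets]
  refine exists_congr fun z => and_congr_right fun _ => ?_
  rw [← Nat.lt_succ_iff, Nat.succ_eq_add_one, ← Fintype.card_option,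
    rank_lt_card_iff_forall_det_eq_zero, Sum.forall, and_comm]
  refine and_congr (forall_congr' fun s => ?_) ?_
  · rw [Sum.elim_inr, eval_specialize_det, iff_iff_eq]
    congr 2
    ext a b
    simp [specialize_pderiv, specialize_universalForm, form_option_elim, xgrad, cderiv_form, o']
  · simp only [Sum.elim_inl, specialize_universalForm, aeval_form]
    constructor
    · exact fun h => ⟨fun i => h i, h q⟩
    · rintro ⟨h1, h2⟩ i
      by_cases hi : i = q
      · rw [hi]; exact h2
      · exact h1 ⟨i, hi⟩

/-- The matrix of the second order condition for forms with indeterminate coefficients. -/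
def universalHessMatrix (e : I → ℕ) (f : I) (o : ι → I) :
    Matrix (Fin n ⊕ Fin n) (Option ι ⊕ ι)
      (MvPolynomial (Fin (n + 1) ⊕ Fin n) (MvPolynomial (Σ i, Expo n (e i)) ℤ)) :=
  Matrix.fromBlocks
    (Matrix.of fun j i => rename Sum.inl (pderiv j.succ (universalForm e (i.elim f o))))
    0
    (Matrix.of fun j i => ∑ k : Fin n,
      rename Sum.inl (pderiv k.succ (pderiv j.succ (universalForm e (i.elim f o)))) * X (Sum.inr k))
    (Matrix.of fun j i => rename Sum.inl (pderiv j.succ (universalForm e (o i))))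

theorem exists_polynomial_kktSingular (e : I → ℕ) (f : I) (o : ι → I) :
    ∃ φ : MvPolynomial (Σ i, Expo n (e i)) ℤ, ∀ c : (Σ i, Expo n (e i)) → ℝ,
      aeval c φ = 0 ↔ KKTSingular (form e f c) fun i => form e (o i) c := by
  -- Row and column parts of the bidegrees in `(x, y)`: gradients have `(e - 1, 0)` and Hessians
  -- times `y` have `(e - 2, 1)`. Negative parts are needed, and the zero block fits any bidegree.
  let r : Fin n ⊕ Fin n → ℤ × ℤ := Sum.elim (fun _ => (0, 0)) fun _ => (-1, 1)
  let s : Option ι ⊕ ι → ℤ × ℤ := Sum.elim (fun i => ((e (i.elim f o) : ℤ) - 1, 0))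
    fun i => ((e (o i) : ℤ), -1)
  have hsum : ∀ (p : Fin n → MvPolynomial (Fin (n + 1)) (MvPolynomial (Σ i, Expo n (e i)) ℤ))
      (a : ℤ), (∀ k, IsWeightedHomogeneous (fun _ => (1 : ℤ)) (p k) a) →
      IsWeightedHomogeneous (biweight (Fin (n + 1)) (Fin n))
        (∑ k, rename Sum.inl (p k) * X (Sum.inr k)) (a, 1) := by
    intro p a hp
    refine IsWeightedHomogeneous.sum _ _ _ fun k _ => ?_
    have := (isWeightedHomogeneous_rename_inl (σ' := Fin n) (hp k)).mul
      (isWeightedHomogeneous_X _ _ (Sum.inr k))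
    convert! this using 1
    simp [biweight]
  have hH : ∀ a b, IsWeightedHomogeneous (biweight (Fin (n + 1)) (Fin n))
      (universalHessMatrix (n := n) e f o a b) (r a + s b) := by
    rintro (a | a) (b | b)
    · have := isWeightedHomogeneous_rename_inl (σ' := Fin n)
        (isWeightedHomogeneous_pderiv_universalForm (n := n) (e := e) (b.elim f o) a.succ)
      convert! this using 1
      simp [r, s]
    · exact isWeightedHomogeneous_zero _ _ _
    · have := hsum (fun k => pderiv k.succ (pderiv a.succ (universalForm e (b.elim f o))))
        ((e (b.elim f o) : ℤ) - 1 - 1) fun k =>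
        (isWeightedHomogeneous_pderiv_universalForm _ _).pderiv (sub_add_cancel _ _)
      convert! this using 1
      simp only [r, s, Sum.elim_inl, Sum.elim_inr, Prod.mk_add_mk, Prod.mk.injEq]
      omega
    · have := isWeightedHomogeneous_rename_inl (σ' := Fin n)
        (isWeightedHomogeneous_pderiv_universalForm (n := n) (e := e) (o b) a.succ)
      convert! this using 1
  obtain ⟨φ, hφ⟩ := exists_polynomial_eliminating_biprojective (σ := Fin (n + 1)) (σ' := Fin n)
    (Sum.elim (Sum.elim (fun i => rename Sum.inl (universalForm (n := n) e (o i)))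
      fun i => ∑ k : Fin n,
        rename Sum.inl (pderiv k.succ (universalForm e (o i))) * X (Sum.inr k))
      fun g : Option ι ⊕ ι → Fin n ⊕ Fin n => ((universalHessMatrix e f o).submatrix g id).det)
    (Sum.elim (Sum.elim (fun i => ((e (o i) : ℤ), 0)) fun i => ((e (o i) : ℤ) - 1, 1))
      fun g => ∑ i, r (g i) + ∑ i, s i) (by
      rintro ((i | i) | g)
      · exact isWeightedHomogeneous_rename_inl (isWeightedHomogeneous_universalForm _)
      · exact hsum _ _ fun k => isWeightedHomogeneous_pderiv_universalForm _ _
      · exact isWeightedHomogeneous_det fun a b => hH _ _)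
  refine ⟨φ, fun c => (hφ c).trans ?_⟩
  refine exists₂_congr fun z y => and_congr_right fun _ => and_congr_right fun _ => ?_
  have hmat : (universalHessMatrix e f o).map (fun p => eval (Sum.elim z y) (specialize c p)) =
      hessMatrix (form e f c) (fun i => form e (o i) c) z y := by
    ext (a | a) (b | b)
    · simp [universalHessMatrix, hessMatrix, specialize_rename, eval_rename, specialize_pderiv,
        specialize_universalForm, form_option_elim, xgrad, cderiv_form]
    · simp [universalHessMatrix, hessMatrix]
    · simp [universalHessMatrix, hessMatrix, specialize_rename, eval_rename, specialize_pderiv,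
        specialize_universalForm, form_option_elim, xhess, cderiv_pderiv_form, Matrix.mulVec,
        dotProduct]
      simp [specialize]
    · simp [universalHessMatrix, hessMatrix, specialize_rename, eval_rename, specialize_pderiv,
        specialize_universalForm, xgrad, cderiv_form]
  have hcard : 2 * Fintype.card ι + 1 = Fintype.card (Option ι ⊕ ι) := by
    rw [Fintype.card_sum, Fintype.card_option]
    omega
  rw [← Nat.lt_succ_iff, Nat.succ_eq_add_one, hcard, rank_lt_card_iff_forall_det_eq_zero,
    Sum.forall, Sum.forall, and_comm]
  refine and_congr (forall_congr' fun g => ?_) (and_congr (forall_congr' fun i => ?_)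
    (forall_congr' fun i => ?_))
  · rw [Sum.elim_inr, eval_specialize_det, ← hmat]
    rfl
  · simp [specialize_rename, eval_rename, specialize_universalForm, aeval_form]
  · simp only [Sum.elim_inl, Sum.elim_inr, map_sum, map_mul, specialize_rename, eval_rename,
      specialize_pderiv, specialize_universalForm, dotProduct, xgrad, cderiv_form]
    simp [specialize]

end Universal

theorem exists_restrictTotalDegree_coeff_eq {n e : ℕ} (c : Expo n e → ℝ) :
    ∃ p : restrictTotalDegree (Fin n) ℝ e,
      ∀ α : Expo n e, coeff α.1 (p : MvPolynomial (Fin n) ℝ) = c α := by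
  classical
  refine ⟨⟨∑ α, monomial α.1 (c α), Submodule.sum_mem _ fun α _ => ?_⟩, fun α => ?_⟩
  · rw [mem_restrictTotalDegree]
    refine (totalDegree_monomial_le _ _).trans ?_
    have := α.2
    rwa [Finsupp.degree_eq_sum, ← Finsupp.sum_fintype _ (fun _ m => m) fun _ => rfl] at this
  · rw [coeff_sum, Finset.sum_eq_single α]
    · simp
    · intro β _ hβ
      rw [coeff_monomial, if_neg fun h => hβ (Subtype.ext h)]
    · simp

/-! ### The input as a single family of forms, and nonzero polynomials for its loci -/

namespace Input

variable {n m₁ m₂ d₀ : ℕ} {d : Fin m₁ → ℕ} {d' : Fin m₂ → ℕ}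

/-- The degree bounds of all input polynomials, the objective having the index `none`. -/
def degs (d₀ : ℕ) (d : Fin m₁ → ℕ) (d' : Fin m₂ → ℕ) (i : Option (Fin m₁ ⊕ Fin m₂)) : ℕ :=
  i.elim d₀ (Sum.elim d d')

/-- The coefficient variables, as variables of a single family of polynomials. -/
def toVar : (Σ i, Expo n (degs d₀ d d' i)) → CoeffVar n d₀ d d'
  | ⟨none, α⟩ => Sum.inl α
  | ⟨some (Sum.inl i), α⟩ => Sum.inr (Sum.inl ⟨i, α⟩)
  | ⟨some (Sum.inr j), α⟩ => Sum.inr (Sum.inr ⟨j, α⟩)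

/-- The coefficients of the input polynomials, as coefficients of a single family. -/
def famCoeffs (P : Input n d₀ d d') : (Σ i, Expo n (degs d₀ d d' i)) → ℝ := P.coeffs ∘ toVar

theorem exists_famCoeffs_eq (c : (Σ i, Expo n (degs d₀ d d' i)) → ℝ) :
    ∃ P : Input n d₀ d d', P.famCoeffs = c := by
  obtain ⟨f, hf⟩ := exists_restrictTotalDegree_coeff_eq (e := d₀) fun α => c ⟨none, α⟩
  choose h hh using fun i => exists_restrictTotalDegree_coeff_eq (e := d i)
    fun α => c ⟨some (Sum.inl i), α⟩
  choose g hg using fun j => exists_restrictTotalDegree_coeff_eq (e := d' j)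
    fun α => c ⟨some (Sum.inr j), α⟩
  refine ⟨⟨f, h, g⟩, funext ?_⟩
  rintro ⟨_ | i | j, α⟩
  · exact hf α
  · exact hh i α
  · exact hg j α

/-- The indices of the family `(h, (g j)_{j ∈ T})`. -/
def famIdx (T : Finset (Fin m₂)) (i : Fin m₁ ⊕ T) : Option (Fin m₁ ⊕ Fin m₂) :=
  some (i.map id Subtype.val)

theorem famIdx_injective (T : Finset (Fin m₂)) :
    Function.Injective (famIdx T : Fin m₁ ⊕ T → _) :=
  (Option.some_injective _).comp (Sum.map_injective.2 ⟨Function.injective_id,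
    Subtype.val_injective⟩)

theorem card_famIdx (T : Finset (Fin m₂)) : Fintype.card (Fin m₁ ⊕ T) = m₁ + T.card := by
  simp

theorem elim_famIdx_injective {ι : Type*} {T : Finset (Fin m₂)} {g : ι → Fin m₁ ⊕ T}
    (hg : Function.Injective g) :
    Function.Injective fun i : Option ι => i.elim none fun i => famIdx T (g i) := by
  rintro (_ | i) (_ | j) h
  · rfl
  · simp [famIdx] at h
  · simp [famIdx] at h
  · exact congrArg some (hg (famIdx_injective T h))

theorem fH_eq_form (P : Input n d₀ d d') : P.fH = form (degs d₀ d d') none P.famCoeffs := by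
  rw [fH, homog_eq_sum, form_apply]
  rfl

theorem famH_eq_form (P : Input n d₀ d d') (T : Finset (Fin m₂)) (i : Fin m₁ ⊕ T) :
    P.famH T i = form (degs d₀ d d') (famIdx T i) P.famCoeffs := by
  rcases i with i | j
  · rw [famH, homog_eq_sum, form_apply]
    rfl
  · rw [famH, homog_eq_sum, form_apply]
    rfl

/-- Elimination provides the polynomial and thinness shows that it is nonzero: the zero polynomial
would put every real input into the locus, but a thin set misses some real point. -/
theorem exists_polynomial_of_thin {D : Input n d₀ d d' → Prop}
    {D' : ((Σ i, Expo n (degs d₀ d d' i)) → ℝ) → Prop} (hD : ∀ P, D P ↔ D' P.famCoeffs)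
    (hφ : ∃ φ : MvPolynomial (Σ i, Expo n (degs d₀ d d' i)) ℤ, ∀ c, aeval c φ = 0 ↔ D' c)
    {Z : Set ((Σ i, Expo n (degs d₀ d d' i)) → ℂ)} (hZ : Thin Z)
    (hDZ : ∀ c, D' c → (fun p => (c p : ℂ)) ∈ Z) :
    ∃ φ : MvPolynomial (CoeffVar n d₀ d d') ℤ, φ ≠ 0 ∧ ∀ P : Input n d₀ d d',
      aeval P.coeffs φ = 0 ↔ D P := by
  obtain ⟨φ, hφ⟩ := hφ
  have h1 : ∀ P : Input n d₀ d d', aeval P.coeffs (rename toVar φ) = 0 ↔ D P := by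
    intro P
    rw [aeval_rename, hD]
    exact hφ _
  refine ⟨rename toVar φ, ?_, h1⟩
  intro h0
  obtain ⟨c, hc⟩ := hZ.exists_real_notMem
  obtain ⟨P, rfl⟩ := exists_famCoeffs_eq c
  refine hc (hDZ _ ((hD P).1 ((h1 P).1 ?_)))
  rw [h0, map_zero]

theorem exists_polynomial_degenerate (hd₀ : 0 < d₀) (hd : ∀ i, 0 < d i) (hd' : ∀ j, 0 < d' j)
    (x : CondIndex n m₁ m₂) :
    ∃ φ : MvPolynomial (CoeffVar n d₀ d d') ℤ, φ ≠ 0 ∧ ∀ P : Input n d₀ d d',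
      aeval P.coeffs φ = 0 ↔ P.Degenerate x := by
  classical
  have he : ∀ i, 0 < degs d₀ d d' i := by
    rintro (_ | i | j)
    · exact hd₀
    · exact hd i
    · exact hd' j
  cases x with
  | res T hT =>
    refine exists_polynomial_of_thin (fun P => ?_)
      (exists_polynomial_hasCommonZero _ (famIdx T))
      (thin_dependentLocus he (famIdx_injective T) (famIdx_injective T) le_rfl)
      fun c hc => mem_dependentLocus_of_hasCommonZero (by rw [card_famIdx]; omega) hc
    rw [Degenerate, funext (P.famH_eq_form T)]
  | disc T hT =>
    refine exists_polynomial_of_thin (fun P => ?_)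
      (exists_polynomial_hasSingularZero _ (famIdx T))
      (thin_dependentLocus he (famIdx_injective T) (famIdx_injective T) le_rfl)
      fun c hc => mem_dependentLocus_of_hasSingularZero hc
    rw [Degenerate, funext (P.famH_eq_form T)]
  | kkt T hT q =>
    refine exists_polynomial_of_thin (fun P => ?_)
      (exists_polynomial_kktMeets _ none (famIdx T) q)
      (thin_dependentLocus he (famIdx_injective T)
        (elim_famIdx_injective (g := fun i : {i // i ≠ q} => i.1) Subtype.val_injective) ?_)
      fun c hc => mem_dependentLocus_of_kktMeets hc
    · rw [Degenerate, funext (P.famH_eq_form T), fH_eq_form]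
    · rw [Fintype.card_option, Fintype.card_subtype_compl, Fintype.card_subtype_eq]
      have : 0 < Fintype.card (Fin m₁ ⊕ T) := Fintype.card_pos_iff.2 ⟨q⟩
      omega
  | hess T hT =>
    have ho := elim_famIdx_injective (T := T) (m₁ := m₁) Function.injective_id
    refine exists_polynomial_of_thin (fun P => ?_)
      (exists_polynomial_kktSingular _ none (famIdx T))
      ((((thin_dependentLocus he (famIdx_injective T) (famIdx_injective T) le_rfl).union
        (thin_dependentLocus he ho ho le_rfl)).union
        (thin_dependentLocus he (ho.comp Subtype.val_injective)
          (ho.comp Subtype.val_injective) le_rfl)).union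
        (Thin.iUnion fun l => thin_hessianLocus two_ne_zero he ho l.2))
      fun c hc => mem_locus_of_kktSingular he (by rw [card_famIdx]; exact hT) hc
    rw [Degenerate, funext (P.famH_eq_form T), fH_eq_form]

end Input

instance (n m₁ m₂ : ℕ) : Finite (CondIndex n m₁ m₂) := by
  let g : CondIndex n m₁ m₂ → (Finset (Fin m₂) ⊕ Finset (Fin m₂)) ⊕
      (Finset (Fin m₂) ⊕ Σ T : Finset (Fin m₂), Fin m₁ ⊕ T)
    | .res T _ => .inl (.inl T)
    | .disc T _ => .inl (.inr T)
    | .kkt T _ q => .inr (.inr ⟨T, q⟩)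
    | .hess T _ => .inr (.inl T)
  refine Finite.of_injective g ?_
  rintro (⟨T, _⟩ | ⟨T, _⟩ | ⟨T, _, q⟩ | ⟨T, _⟩) (⟨T', _⟩ | ⟨T', _⟩ | ⟨T', _, q'⟩ | ⟨T', _⟩) h <;>
    simp only [g, Sum.inl.injEq, Sum.inr.injEq, reduceCtorEq, Sigma.mk.injEq] at h
  · subst h; rfl
  · subst h; rfl
  · obtain ⟨rfl, h⟩ := h
    cases h
    rfl
  · subst h; rfl

open Filter Topology

/-! ### Polynomials as smooth functions -/

section Calculus

variable {n : ℕ}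

theorem grad_add (p q : MvPolynomial (Fin n) ℝ) (u : Fin n → ℝ) :
    grad (p + q) u = grad p u + grad q u := by
  ext i
  simp [grad]

theorem grad_mul (p q : MvPolynomial (Fin n) ℝ) (u : Fin n → ℝ) :
    grad (p * q) u = eval u p • grad q u + eval u q • grad p u := by
  ext i
  simp [grad]

theorem grad_C (a : ℝ) (u : Fin n → ℝ) : grad (C a) u = 0 := by
  ext i
  simp [grad]

theorem grad_X (k : Fin n) (u : Fin n → ℝ) : grad (X k) u = Pi.single k 1 := by
  ext i
  by_cases h : i = k
  · subst h
    simp [grad]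
  · simp [grad, pderiv_X_of_ne (Ne.symm h), h]

/-- The linear functional `v ↦ a ⬝ᵥ v`. -/
def dotCLM (a : Fin n → ℝ) : (Fin n → ℝ) →L[ℝ] ℝ :=
  ∑ i, a i • ContinuousLinearMap.proj (R := ℝ) (φ := fun _ : Fin n => ℝ) i

theorem dotCLM_apply (a v : Fin n → ℝ) : dotCLM a v = a ⬝ᵥ v := by
  simp [dotCLM, dotProduct]

theorem hasStrictFDerivAt_eval (p : MvPolynomial (Fin n) ℝ) (u : Fin n → ℝ) :
    HasStrictFDerivAt (fun x => eval x p) (dotCLM (grad p u)) u := by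
  induction p using MvPolynomial.induction_on with
  | C a =>
    simp only [eval_C]
    refine (hasStrictFDerivAt_const a u).congr_fderiv ?_
    ext v
    simp [grad_C, dotCLM_apply]
  | add p q hp hq =>
    simp only [map_add]
    refine (hp.add hq).congr_fderiv ?_
    ext v
    simp [grad_add, dotCLM_apply]
  | mul_X p k hp =>
    simp only [map_mul, eval_X]
    refine (hp.mul (hasStrictFDerivAt_apply k u)).congr_fderiv ?_
    ext v
    simp [grad_mul, grad_X, dotCLM_apply, add_dotProduct]

theorem pderiv_pderiv_comm {σ R : Type*} [CommRing R] (i j : σ) (p : MvPolynomial σ R) :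
    pderiv i (pderiv j p) = pderiv j (pderiv i p) := by
  classical
  have : ⁅(pderiv i : Derivation R (MvPolynomial σ R) (MvPolynomial σ R)),
      (pderiv j : Derivation R (MvPolynomial σ R) (MvPolynomial σ R))⁆ = 0 := by
    refine derivation_ext fun k => ?_
    rw [Derivation.commutator_apply]
    simp [pderiv_X, Pi.single_apply, apply_ite]
  have h := congrArg (fun D : Derivation R (MvPolynomial σ R) (MvPolynomial σ R) => D p) this
  simpa [Derivation.commutator_apply, sub_eq_zero] using h

theorem hessian_symm (p : MvPolynomial (Fin n) ℝ) (u : Fin n → ℝ) :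
    (hessian p u).transpose = hessian p u := by
  ext i j
  simp [hessian, pderiv_pderiv_comm]

/-- The second order Taylor formula with polynomial remainder. -/
theorem exists_taylor (p : MvPolynomial (Fin n) ℝ) (u : Fin n → ℝ) :
    ∃ R : Fin n → Fin n → MvPolynomial (Fin n) ℝ,
      (∀ w, eval (u + w) p = eval u p + grad p u ⬝ᵥ w +
        ∑ i, ∑ j, eval w (R i j) * w i * w j) ∧
      ∀ i j, eval 0 (R i j) + eval 0 (R j i) = hessian p u i j := by
  induction p using MvPolynomial.induction_on with
  | C a =>
    refine ⟨fun _ _ => 0, fun w => by simp [grad_C], fun i j => by simp [hessian]⟩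
  | add p q hp hq =>
    obtain ⟨R, h1, h2⟩ := hp
    obtain ⟨S, h3, h4⟩ := hq
    refine ⟨fun i j => R i j + S i j, fun w => ?_, fun i j => ?_⟩
    · simp only [map_add, h1, h3, grad_add, add_dotProduct, add_mul, Finset.sum_add_distrib]
      ring
    · have e1 := h2 i j
      have e2 := h4 i j
      simp only [hessian, Matrix.of_apply, map_add] at e1 e2 ⊢
      linarith
  | mul_X p k hp =>
    obtain ⟨R, h1, h2⟩ := hp
    -- Multiplying the expansion of `p` by `u k + w k`, the second order terms are `(grad p u ⬝ᵥ w)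
    -- * w k` and the old remainder times `u k + w k`.
    refine ⟨fun i j => C (grad p u i * if j = k then 1 else 0) + (C (u k) + X k) * R i j,
      fun w => ?_, fun i j => ?_⟩
    · have e1 : ∑ i, ∑ j, eval w (C (grad p u i * if j = k then 1 else 0) +
          (C (u k) + X k) * R i j) * w i * w j =
          (grad p u ⬝ᵥ w) * w k + (u k + w k) * ∑ i, ∑ j, eval w (R i j) * w i * w j := by
        simp only [map_add, map_mul, eval_C, eval_X, dotProduct, Finset.sum_mul, Finset.mul_sum]
        rw [← Finset.sum_add_distrib]
        refine Finset.sum_congr rfl fun i _ => ?_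
        have e2 : grad p u i * w i * w k =
            ∑ j, grad p u i * (if j = k then 1 else 0) * w i * w j := by
          rw [Finset.sum_eq_single k]
          · simp
          · intro j _ hj; simp [hj]
          · simp
        rw [e2, ← Finset.sum_add_distrib]
        refine Finset.sum_congr rfl fun j _ => ?_
        ring
      rw [e1, map_mul, h1, grad_mul, grad_X, add_dotProduct, smul_dotProduct, smul_dotProduct,
        single_dotProduct]
      simp only [eval_X, Pi.add_apply, map_mul, smul_eq_mul, one_mul]
      ring
    · have e1 := h2 i j
      simp only [hessian, Matrix.of_apply] at e1 ⊢
      have e3 : ∀ a b : Fin n, eval u (pderiv a (X b : MvPolynomial (Fin n) ℝ)) =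
          if a = b then 1 else 0 := by
        intro a b
        have := congrFun (grad_X b u) a
        rw [Pi.single_apply] at this
        exact this
      have e4 : ∀ a b c : Fin n, pderiv a (pderiv b (X c : MvPolynomial (Fin n) ℝ)) = 0 := by
        classical
        intro a b c
        rw [pderiv_X, Pi.single_apply]
        split_ifs <;> simp
      simp only [pderiv_mul, map_add, map_mul, e3, e4, ← e1, eval_X, eval_C, Pi.zero_apply,
        add_zero, mul_zero, grad]
      ring

/-- Along a curve through a critical point, a polynomial grows to second order by half of its
Hessian. -/
theorem tendsto_second_difference {p : MvPolynomial (Fin n) ℝ} {u v : Fin n → ℝ}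
    (hp : grad p u = 0) {x : ℝ → Fin n → ℝ} (hx0 : x 0 = u) (hx : HasDerivAt x v 0) :
    Tendsto (fun s => (eval (x s) p - eval u p) / s ^ 2) (𝓝[≠] 0)
      (𝓝 ((v ⬝ᵥ (hessian p u).mulVec v) / 2)) := by
  obtain ⟨R, h1, h2⟩ := exists_taylor p u
  have hw : Tendsto (fun s => x s - u) (𝓝[≠] 0) (𝓝 0) := by
    have := (hx.continuousAt.tendsto.mono_left (nhdsWithin_le_nhds (s := {0}ᶜ))).sub_const u
    rwa [hx0, sub_self] at this
  have hws : ∀ i, Tendsto (fun s => (x s - u) i / s) (𝓝[≠] 0) (𝓝 (v i)) := by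
    intro i
    have := hasDerivAt_iff_tendsto_slope_zero.1 (hasDerivAt_pi.1 hx i)
    simp only [zero_add, hx0, smul_eq_mul] at this
    refine this.congr fun s => ?_
    rw [Pi.sub_apply, div_eq_inv_mul]
  have hlim : Tendsto (fun s => ∑ i, ∑ j, eval (x s - u) (R i j) * ((x s - u) i / s) *
      ((x s - u) j / s)) (𝓝[≠] 0) (𝓝 (∑ i, ∑ j, eval 0 (R i j) * v i * v j)) := by
    refine tendsto_finsetSum _ fun i _ => tendsto_finsetSum _ fun j _ => ?_
    exact ((((MvPolynomial.continuous_eval (R i j)).tendsto 0).comp hw).mul (hws i)).mul (hws j)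
  have hval : ∑ i, ∑ j, eval 0 (R i j) * v i * v j = (v ⬝ᵥ (hessian p u).mulVec v) / 2 := by
    have e1 : v ⬝ᵥ (hessian p u).mulVec v = ∑ i, ∑ j, (eval 0 (R i j) + eval 0 (R j i)) *
        v i * v j := by
      simp only [dotProduct, Matrix.mulVec, Finset.mul_sum, h2]
      refine Finset.sum_congr rfl fun i _ => Finset.sum_congr rfl fun j _ => ?_
      ring
    have e2 : ∑ i, ∑ j, eval 0 (R j i) * v i * v j = ∑ i, ∑ j, eval 0 (R i j) * v i * v j := by
      rw [Finset.sum_comm]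
      refine Finset.sum_congr rfl fun i _ => Finset.sum_congr rfl fun j _ => ?_
      ring
    rw [e1]
    simp only [add_mul, Finset.sum_add_distrib]
    rw [e2]
    ring
  rw [← hval]
  refine hlim.congr' ?_
  filter_upwards [self_mem_nhdsWithin] with s hs
  have hs' : s ≠ 0 := hs
  have e3 := h1 (x s - u)
  rw [add_sub_cancel, hp, zero_dotProduct, add_zero] at e3
  rw [e3, add_sub_cancel_left, Finset.sum_div]
  refine Finset.sum_congr rfl fun i _ => ?_
  rw [Finset.sum_div]
  refine Finset.sum_congr rfl fun j _ => ?_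
  field_simp

end Calculus

/-! ### Linear algebra of gradients -/

section LinearAlgebra

variable {n : ℕ} {ι : Type*} [Fintype ι]

theorem exists_eq_sum_smul_of_forall_dotProduct_eq_zero (a : ι → Fin n → ℝ) (b : Fin n → ℝ)
    (h : ∀ v, (∀ i, a i ⬝ᵥ v = 0) → b ⬝ᵥ v = 0) : ∃ ν : ι → ℝ, b = ∑ i, ν i • a i := by
  have := mem_span_of_iInf_ker_le_ker (L := fun i => (dotCLM (a i)).toLinearMap)
    (K := (dotCLM b).toLinearMap) (by
      intro v hv
      simp only [Submodule.mem_iInf, LinearMap.mem_ker, ContinuousLinearMap.coe_coe,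
        dotCLM_apply] at hv ⊢
      exact h v hv)
  obtain ⟨ν, hν⟩ := (Submodule.mem_span_range_iff_exists_fun ℝ).1 this
  refine ⟨ν, funext fun k => ?_⟩
  have := congrArg (fun L => L (Pi.single k 1)) hν
  simp only [LinearMap.sum_apply, LinearMap.smul_apply, ContinuousLinearMap.coe_coe,
    dotCLM_apply, dotProduct_single_one, smul_eq_mul] at this
  simp [← this]

theorem surjective_of_linearIndependent {a : ι → Fin n → ℝ} (ha : LinearIndependent ℝ a)
    (r : ι → ℝ) : ∃ v, ∀ i, a i ⬝ᵥ v = r i := by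
  have h1 : (Matrix.of a).rank = Fintype.card ι := LinearIndependent.rank_matrix ha
  have h2 : LinearMap.range (Matrix.of a).mulVecLin = ⊤ := by
    apply Submodule.eq_top_of_finrank_eq
    rw [Module.finrank_fintype_fun_eq_card]
    exact h1
  obtain ⟨v, hv⟩ := LinearMap.range_eq_top.1 h2 r
  exact ⟨v, fun i => congrFun hv i⟩

/-- Through a point of an intersection of hypersurfaces with linearly independent gradients, there
is a curve in the intersection with any given tangent vector. -/
theorem exists_curve_of_tangent {p : ι → MvPolynomial (Fin n) ℝ} {u v : Fin n → ℝ}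
    (hli : LinearIndependent ℝ fun i => grad (p i) u) (hu : ∀ i, eval u (p i) = 0)
    (hv : ∀ i, grad (p i) u ⬝ᵥ v = 0) :
    ∃ x : ℝ → Fin n → ℝ, x 0 = u ∧ HasDerivAt x v 0 ∧ ∀ᶠ s in 𝓝 0, ∀ i, eval (x s) (p i) = 0 := by
  let G : (Fin n → ℝ) → ι → ℝ := fun x i => eval x (p i)
  let G' : (Fin n → ℝ) →L[ℝ] ι → ℝ := ContinuousLinearMap.pi fun i => dotCLM (grad (p i) u)
  have hG : HasStrictFDerivAt G G' u :=
    hasStrictFDerivAt_pi.2 fun i => hasStrictFDerivAt_eval (p i) u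
  have hrange : G'.range = ⊤ := by
    refine LinearMap.range_eq_top.2 fun r => ?_
    obtain ⟨v, hv⟩ := surjective_of_linearIndependent hli r
    exact ⟨v, funext fun i => by simpa [G', dotCLM_apply] using hv i⟩
  have hvk : v ∈ G'.ker := by
    refine LinearMap.mem_ker.2 (funext fun i => ?_)
    simpa [G', dotCLM_apply] using hv i
  have hGu : G u = 0 := funext hu
  -- The curve is the image of the line `s • v` in the tangent space under the implicit function.
  let c : ℝ → G'.ker := fun s => s • ⟨v, hvk⟩
  have hc : HasDerivAt c ⟨v, hvk⟩ 0 := by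
    have := (hasDerivAt_id (0 : ℝ)).smul_const (⟨v, hvk⟩ : G'.ker)
    rwa [one_smul] at this
  have hc0 : c 0 = 0 := zero_smul _ _
  refine ⟨fun s => hG.implicitFunction G G' hrange (G u) (c s), ?_, ?_, ?_⟩
  · simp only [hc0]
    exact hG.implicitFunction_apply_image hrange
  · have h1 := (hG.to_implicitFunction hrange).hasFDerivAt
    rw [← hc0] at h1
    exact h1.comp_hasDerivAt 0 hc
  · have h1 : Tendsto (fun s => (G u, c s)) (𝓝 0) (𝓝 (G u, 0)) := by
      refine tendsto_const_nhds.prodMk_nhds ?_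
      rw [← hc0]
      exact hc.continuousAt
    filter_upwards [h1.eventually (hG.map_implicitFunction_eq hrange)] with s hs i
    have := congrFun hs i
    simpa [hGu] using this

end LinearAlgebra

/-! ### First and second order conditions for equality constraints -/

section Conditions

variable {n : ℕ} {ι : Type*} [Fintype ι] {f : MvPolynomial (Fin n) ℝ}
  {p : ι → MvPolynomial (Fin n) ℝ} {u : Fin n → ℝ}

theorem hasDerivAt_eval_comp (q : MvPolynomial (Fin n) ℝ) {x : ℝ → Fin n → ℝ} {v : Fin n → ℝ}
    (hx0 : x 0 = u) (hx : HasDerivAt x v 0) :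
    HasDerivAt (fun s => eval (x s) q) (grad q u ⬝ᵥ v) 0 := by
  have h := (hasStrictFDerivAt_eval q (x 0)).hasFDerivAt.comp_hasDerivAt 0 hx
  rwa [dotCLM_apply, hx0] at h

theorem eventually_le_of_isLocalMinOn {S : Set (Fin n → ℝ)}
    (hmin : IsLocalMinOn (fun x => eval x f) S u) {l : Filter ℝ} {x : ℝ → Fin n → ℝ}
    (hx : Tendsto x l (𝓝 u)) (hS : ∀ᶠ s in l, x s ∈ S) :
    ∀ᶠ s in l, eval u f ≤ eval (x s) f :=
  (tendsto_nhdsWithin_iff.2 ⟨hx, hS⟩).eventually hmin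

/-- The Lagrange multiplier rule. -/
theorem exists_multipliers (hli : LinearIndependent ℝ fun i => grad (p i) u)
    (hu : ∀ i, eval u (p i) = 0)
    (hmin : IsLocalMinOn (fun x => eval x f) {x | ∀ i, eval x (p i) = 0} u) :
    ∃ ν : ι → ℝ, grad f u = ∑ i, ν i • grad (p i) u := by
  refine exists_eq_sum_smul_of_forall_dotProduct_eq_zero _ _ fun v hv => ?_
  obtain ⟨x, hx0, hx, hxp⟩ := exists_curve_of_tangent hli hu hv
  have hxt : Tendsto x (𝓝 0) (𝓝 u) := by
    simpa only [hx0] using hx.continuousAt.tendsto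
  have hloc : IsLocalMin (fun s => eval (x s) f) 0 := by
    have := eventually_le_of_isLocalMinOn hmin hxt hxp
    rw [← hx0] at this
    exact this
  exact hloc.hasDerivAt_eq_zero (hasDerivAt_eval_comp f hx0 hx)

/-- The multiplier of an inequality constraint is nonnegative. -/
theorem multiplier_nonneg (hli : LinearIndependent ℝ fun i => grad (p i) u)
    (hu : ∀ i, eval u (p i) = 0) {k : ι}
    (hmin : IsLocalMinOn (fun x => eval x f)
      {x | (∀ i, i ≠ k → eval x (p i) = 0) ∧ 0 ≤ eval x (p k)} u)
    {ν : ι → ℝ} (hν : grad f u = ∑ i, ν i • grad (p i) u) : 0 ≤ ν k := by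
  classical
  -- A direction tangent to all constraints but `k`, along which constraint `k` increases at unit
  -- rate: it is feasible for positive parameters, and `f` has slope `ν k` along it.
  obtain ⟨v, hv⟩ := surjective_of_linearIndependent hli (Pi.single k 1)
  obtain ⟨x, hx0, hx, hxp⟩ := exists_curve_of_tangent (p := fun i : {i // i ≠ k} => p i)
    (hli.comp _ Subtype.val_injective) (fun i => hu i)
    (fun i => by rw [hv, Pi.single_eq_of_ne i.2])
  have hfv : grad f u ⬝ᵥ v = ν k := by
    rw [hν, sum_dotProduct]
    simp [hv, Pi.single_apply]
  have hxt : Tendsto x (𝓝[>] 0) (𝓝 u) := by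
    simpa only [hx0] using hx.continuousAt.tendsto.mono_left nhdsWithin_le_nhds
  have hslope : ∀ q : MvPolynomial (Fin n) ℝ,
      Tendsto (fun s => s⁻¹ * (eval (x s) q - eval u q)) (𝓝[>] 0) (𝓝 (grad q u ⬝ᵥ v)) := by
    intro q
    have := (hasDerivAt_iff_tendsto_slope_zero.1 (hasDerivAt_eval_comp q hx0 hx)).mono_left
      (nhdsWithin_mono (0 : ℝ) (show Set.Ioi (0 : ℝ) ⊆ {0}ᶜ from fun s hs => ne_of_gt hs))
    simpa only [zero_add, hx0, smul_eq_mul] using this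
  have hpos : ∀ᶠ s in 𝓝[>] (0 : ℝ), 0 < s⁻¹ * (eval (x s) (p k) - eval u (p k)) := by
    refine (hslope (p k)).eventually (lt_mem_nhds ?_)
    rw [hv, Pi.single_eq_same]
    exact one_pos
  have hle : ∀ᶠ s in 𝓝[>] (0 : ℝ), eval u f ≤ eval (x s) f := by
    refine eventually_le_of_isLocalMinOn hmin hxt ?_
    filter_upwards [hpos, self_mem_nhdsWithin, nhdsWithin_le_nhds hxp] with s h1 h2 h3
    refine ⟨fun i hi => h3 ⟨i, hi⟩, ?_⟩
    rw [hu k, sub_zero] at h1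
    exact (pos_of_mul_pos_right h1 (inv_pos.2 h2).le).le
  rw [← hfv]
  refine ge_of_tendsto (hslope f) ?_
  filter_upwards [hle, self_mem_nhdsWithin] with s h1 h2
  exact mul_nonneg (inv_pos.2 h2).le (sub_nonneg.2 h1)

theorem grad_sub_sum (ν : ι → ℝ) :
    grad (f - ∑ i, C (ν i) * p i) u = grad f u - ∑ i, ν i • grad (p i) u := by
  ext k
  simp [grad, map_sum, Finset.sum_apply]

theorem hessian_sub_sum (ν : ι → ℝ) :
    hessian (f - ∑ i, C (ν i) * p i) u = hessian f u - ∑ i, ν i • hessian (p i) u := by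
  ext k l
  simp [hessian, map_sum, Matrix.sum_apply]

/-- The second order necessary condition. -/
theorem hessian_nonneg_of_tangent (hli : LinearIndependent ℝ fun i => grad (p i) u)
    (hu : ∀ i, eval u (p i) = 0)
    (hmin : IsLocalMinOn (fun x => eval x f) {x | ∀ i, eval x (p i) = 0} u)
    {ν : ι → ℝ} (hν : grad f u = ∑ i, ν i • grad (p i) u) {v : Fin n → ℝ}
    (hv : ∀ i, grad (p i) u ⬝ᵥ v = 0) :
    0 ≤ v ⬝ᵥ (hessian (f - ∑ i, C (ν i) * p i) u).mulVec v := by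
  obtain ⟨x, hx0, hx, hxp⟩ := exists_curve_of_tangent hli hu hv
  have hxt : Tendsto x (𝓝 0) (𝓝 u) := by
    simpa only [hx0] using hx.continuousAt.tendsto
  have h := tendsto_second_difference (p := f - ∑ i, C (ν i) * p i)
    (by rw [grad_sub_sum, hν, sub_self]) hx0 hx
  have h2 : 0 ≤ (v ⬝ᵥ (hessian (f - ∑ i, C (ν i) * p i) u).mulVec v) / 2 := by
    -- On the curve the constraints vanish, so the Lagrangian and `f` agree there and the difference
    -- quotient is nonnegative.
    refine ge_of_tendsto h ?_
    filter_upwards [nhdsWithin_le_nhds (eventually_le_of_isLocalMinOn hmin hxt hxp),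
      nhdsWithin_le_nhds hxp] with s h1 h2
    refine div_nonneg ?_ (sq_nonneg s)
    simp only [map_sub, map_sum, map_mul, h2, hu, mul_zero, Finset.sum_const_zero, sub_zero]
    linarith
  linarith

/-- A symmetric form which is nonnegative on the orthogonal complement of some vectors maps its
isotropic vectors there into the span of these vectors. -/
theorem exists_mulVec_eq_sum_smul {H : Matrix (Fin n) (Fin n) ℝ} (hH : H.transpose = H)
    {a : ι → Fin n → ℝ} (hpos : ∀ v, (∀ i, a i ⬝ᵥ v = 0) → 0 ≤ v ⬝ᵥ H.mulVec v)
    {v : Fin n → ℝ} (hv : ∀ i, a i ⬝ᵥ v = 0) (hv0 : v ⬝ᵥ H.mulVec v = 0) :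
    ∃ κ : ι → ℝ, H.mulVec v = ∑ i, κ i • a i := by
  refine exists_eq_sum_smul_of_forall_dotProduct_eq_zero _ _ fun w hw => ?_
  have hsymm : v ⬝ᵥ H.mulVec w = w ⬝ᵥ H.mulVec v := by
    rw [Matrix.dotProduct_mulVec, ← Matrix.mulVec_transpose, hH, dotProduct_comm]
  have hquad : ∀ t : ℝ, 0 ≤ 2 * t * (w ⬝ᵥ H.mulVec v) + t ^ 2 * (w ⬝ᵥ H.mulVec w) := by
    intro t
    have := hpos (v + t • w) fun i => by rw [dotProduct_add, dotProduct_smul, hv, hw]; simp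
    simp only [Matrix.mulVec_add, Matrix.mulVec_smul, dotProduct_add, add_dotProduct,
      smul_dotProduct, dotProduct_smul, hv0, hsymm, smul_eq_mul] at this
    linarith
  rw [dotProduct_comm]
  set b := w ⬝ᵥ H.mulVec v
  have hc : 0 ≤ w ⬝ᵥ H.mulVec w := hpos w hw
  set c := w ⬝ᵥ H.mulVec w
  -- Near the minimizer `-b / c` of the quadratic; the shift by one keeps the denominator positive
  -- when `c = 0`. The value is negative unless `b = 0`.
  have h1 := hquad (-b / (c + 1))
  have h2 : 2 * (-b / (c + 1)) * b + (-b / (c + 1)) ^ 2 * c = -(b ^ 2 * (c + 2) / (c + 1) ^ 2) := by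
    field_simp
    ring
  rw [h2] at h1
  have h3 : 0 ≤ b ^ 2 * (c + 2) / (c + 1) ^ 2 := by positivity
  have h4 : b ^ 2 * (c + 2) / (c + 1) ^ 2 = 0 := by linarith
  have h5 : c + 1 ≠ 0 := by linarith
  have h6 : c + 2 ≠ 0 := by linarith
  simpa [h5, h6] using h4

end Conditions

/-! ### Dehomogenization -/

section Dehomogenization

variable {n : ℕ}

/-- Setting the homogenizing variable to `1`. -/
def dehom : MvPolynomial (Fin (n + 1)) ℝ →ₐ[ℝ] MvPolynomial (Fin n) ℝ :=
  aeval (Fin.cons 1 X)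

theorem dehom_homog (e : ℕ) (p : MvPolynomial (Fin n) ℝ) : dehom (homog e p) = p := by
  conv_rhs => rw [p.as_sum]
  rw [homog, map_sum]
  refine Finset.sum_congr rfl fun α _ => ?_
  rw [dehom, aeval_monomial, Finsupp.prod_fintype _ _ (by simp), Fin.prod_univ_succ]
  simp only [Fin.cons_zero, one_pow, one_mul, Fin.cons_succ, Finsupp.cons_succ]
  rw [monomial_eq, Finsupp.prod_fintype _ _ (by simp)]
  rfl

theorem dehom_pderiv_succ (j : Fin n) (q : MvPolynomial (Fin (n + 1)) ℝ) :
    dehom (pderiv j.succ q) = pderiv j (dehom q) := by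
  classical
  induction q using MvPolynomial.induction_on with
  | C a => simp [dehom]
  | add p q hp hq => simp [hp, hq]
  | mul_X p k hp =>
    have hX : dehom (pderiv j.succ (X k : MvPolynomial (Fin (n + 1)) ℝ)) =
        pderiv j (dehom (X k)) := by
      refine Fin.cases ?_ (fun k => ?_) k
      · rw [pderiv_X_of_ne (Fin.succ_ne_zero j).symm]
        simp [dehom]
      · simp [dehom, pderiv_X, Pi.single_apply, apply_ite]
    simp only [pderiv_mul, map_add, map_mul, hp, hX]

/-- The point of projective space given by a point of affine space. -/
def affinePoint (u : Fin n → ℝ) : Fin (n + 1) → ℂ :=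
  Fin.cons 1 fun i => (u i : ℂ)

theorem affinePoint_ne_zero (u : Fin n → ℝ) : affinePoint u ≠ 0 := fun h =>
  one_ne_zero (congrFun h 0)

theorem aeval_affinePoint (u : Fin n → ℝ) (q : MvPolynomial (Fin (n + 1)) ℝ) :
    aeval (affinePoint u) q = (eval u (dehom q) : ℂ) := by
  induction q using MvPolynomial.induction_on with
  | C a => simp [dehom]
  | add p q hp hq => simp [hp, hq]
  | mul_X p k hp =>
    rw [map_mul, map_mul, map_mul, hp, Complex.ofReal_mul, aeval_X]
    congr 1
    refine Fin.cases ?_ (fun k => ?_) k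
    · simp [dehom, affinePoint]
    · simp [dehom, affinePoint]

theorem xgrad_affinePoint (u : Fin n → ℝ) (q : MvPolynomial (Fin (n + 1)) ℝ) (j : Fin n) :
    xgrad q (affinePoint u) j = (grad (dehom q) u j : ℂ) := by
  rw [xgrad, cderiv, aeval_affinePoint, dehom_pderiv_succ]
  rfl

theorem xhess_affinePoint (u : Fin n → ℝ) (q : MvPolynomial (Fin (n + 1)) ℝ) (i j : Fin n) :
    xhess q (affinePoint u) i j = (hessian (dehom q) u i j : ℂ) := by
  rw [xhess, Matrix.of_apply, cderiv, aeval_affinePoint, dehom_pderiv_succ, dehom_pderiv_succ]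
  rfl

/-- By Euler's formula at a zero of `q`. Hence a dependence among affine gradients extends to the
full gradients. -/
theorem cderiv_zero_affinePoint (u : Fin n → ℝ) {q : MvPolynomial (Fin (n + 1)) ℝ} {e : ℕ}
    (hq : q.IsHomogeneous e) (hu : eval u (dehom q) = 0) :
    cderiv q (affinePoint u) 0 = -(u ⬝ᵥ grad (dehom q) u : ℝ) := by
  have h := congrArg (aeval (affinePoint u)) hq.sum_X_mul_pderiv
  rw [map_sum, map_nsmul, aeval_affinePoint, hu, Fin.sum_univ_succ] at h
  simp only [map_mul, aeval_X, Complex.ofReal_zero, smul_zero] at h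
  rw [cderiv, eq_neg_iff_add_eq_zero, ← h]
  congr 1
  · simp [affinePoint]
  · rw [dotProduct, Complex.ofReal_sum]
    refine Finset.sum_congr rfl fun j _ => ?_
    rw [Complex.ofReal_mul, ← xgrad_affinePoint]
    simp [affinePoint, xgrad, cderiv]

variable {ι : Type} {q : ι → MvPolynomial (Fin (n + 1)) ℝ} {u : Fin n → ℝ}

theorem hasCommonZero_of_eval_eq_zero (hu : ∀ i, eval u (dehom (q i)) = 0) : HasCommonZero q :=
  ⟨affinePoint u, affinePoint_ne_zero u, fun i => by rw [aeval_affinePoint, hu]; simp⟩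

variable [Fintype ι]

theorem hasSingularZero_of_not_linearIndependent {e : ι → ℕ} (hq : ∀ i, (q i).IsHomogeneous (e i))
    (hu : ∀ i, eval u (dehom (q i)) = 0)
    (h : ¬LinearIndependent ℝ fun i => grad (dehom (q i)) u) : HasSingularZero q := by
  classical
  obtain ⟨ν, hν, k, hk⟩ := Fintype.not_linearIndependent_iff.1 h
  refine ⟨affinePoint u, affinePoint_ne_zero u,
    fun i => by rw [aeval_affinePoint, hu]; simp, ?_⟩
  refine (rank_lt_card_iff_exists_mulVec_eq_zero _).2 ⟨fun i => (ν i : ℂ), ?_, funext fun j => ?_⟩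
  · intro h0
    exact hk (Complex.ofReal_eq_zero.1 (congrFun h0 k))
  · simp only [Matrix.mulVec, dotProduct, Matrix.of_apply, Pi.zero_apply]
    refine Fin.cases ?_ (fun j => ?_) j
    · have := congrArg (fun w => -(u ⬝ᵥ w)) hν
      simp only [dotProduct_sum, dotProduct_smul, dotProduct_zero, smul_eq_mul, neg_zero] at this
      simp only [cderiv_zero_affinePoint u (hq _) (hu _)]
      have h2 := congrArg Complex.ofReal this
      push_cast at h2
      rw [← h2, ← Finset.sum_neg_distrib]
      refine Finset.sum_congr rfl fun i _ => ?_
      ring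
    · have h2 := congrArg Complex.ofReal (congrFun hν j)
      simp only [Finset.sum_apply, Pi.smul_apply, smul_eq_mul, Pi.zero_apply] at h2
      push_cast at h2
      rw [← h2]
      refine Finset.sum_congr rfl fun i _ => ?_
      rw [← xgrad_affinePoint, mul_comm]
      rfl

theorem kktMeets_of_multiplier_eq_zero [DecidableEq ι] {p₀ : MvPolynomial (Fin (n + 1)) ℝ}
    (hu : ∀ i, eval u (dehom (q i)) = 0) {ν : ι → ℝ}
    (hν : grad (dehom p₀) u = ∑ i, ν i • grad (dehom (q i)) u) {k : ι} (hk : ν k = 0) :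
    KKTMeets p₀ (fun i : {i // i ≠ k} => q i) (q k) := by
  refine ⟨affinePoint u, affinePoint_ne_zero u, ?_,
    fun i => by rw [aeval_affinePoint, hu]; simp, by rw [aeval_affinePoint, hu]; simp⟩
  rw [← Nat.lt_succ_iff, Nat.succ_eq_add_one, ← Fintype.card_option]
  refine (rank_lt_card_iff_exists_mulVec_eq_zero _).2
    ⟨fun i => i.elim 1 fun i => -(ν i : ℂ), ?_, funext fun j => ?_⟩
  · intro h0
    exact one_ne_zero (congrFun h0 none)
  · simp only [Matrix.mulVec, dotProduct, Matrix.of_apply, Pi.zero_apply, Fintype.sum_option,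
      Option.elim_none, Option.elim_some, mul_one, xgrad_affinePoint]
    have h1 : grad (dehom p₀) u j = ∑ i : {i // i ≠ k}, ν i * grad (dehom (q i)) u j := by
      rw [hν, Finset.sum_apply, ← Fintype.sum_subtype_add_sum_subtype (fun i => i ≠ k)]
      simp only [Pi.smul_apply, smul_eq_mul, add_eq_left]
      refine Finset.sum_eq_zero fun i _ => ?_
      rw [not_not.1 i.2, hk, zero_mul]
    rw [h1]
    push_cast
    rw [← Finset.sum_add_distrib]
    refine Finset.sum_eq_zero fun i _ => ?_
    ring

theorem kktSingular_of_hessian_mulVec [DecidableEq ι] {p₀ : MvPolynomial (Fin (n + 1)) ℝ}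
    (hu : ∀ i, eval u (dehom (q i)) = 0) {ν κ : ι → ℝ}
    (hν : grad (dehom p₀) u = ∑ i, ν i • grad (dehom (q i)) u) {v : Fin n → ℝ} (hv0 : v ≠ 0)
    (hv : ∀ i, grad (dehom (q i)) u ⬝ᵥ v = 0)
    (hκ : (hessian (dehom p₀ - ∑ i, C (ν i) * dehom (q i)) u).mulVec v =
      ∑ i, κ i • grad (dehom (q i)) u) :
    KKTSingular p₀ q := by
  have hmul : ∀ (r : MvPolynomial (Fin (n + 1)) ℝ) (j : Fin n),
      (xhess r (affinePoint u)).mulVec (fun k => (v k : ℂ)) j =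
        ((hessian (dehom r) u).mulVec v j : ℂ) := by
    intro r j
    simp [Matrix.mulVec, dotProduct, xhess_affinePoint]
  refine ⟨affinePoint u, fun k => (v k : ℂ), affinePoint_ne_zero u, ?_, ?_,
    fun i => by rw [aeval_affinePoint, hu]; simp, fun i => ?_⟩
  · intro h0
    exact hv0 (funext fun k => Complex.ofReal_eq_zero.1 (congrFun h0 k))
  · have hcard : Fintype.card (Option ι ⊕ ι) = 2 * Fintype.card ι + 1 := by
      rw [Fintype.card_sum, Fintype.card_option]
      ring
    rw [← Nat.lt_succ_iff, Nat.succ_eq_add_one, ← hcard]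
    -- The kernel vector is `(1, -ν, -κ)`: the upper rows are the multiplier rule, the lower rows
    -- are `hκ`.
    refine (rank_lt_card_iff_exists_mulVec_eq_zero _).2
      ⟨Sum.elim (fun i => i.elim 1 fun i => -(ν i : ℂ)) fun i => -(κ i : ℂ), ?_, ?_⟩
    · intro h0
      exact one_ne_zero (congrFun h0 (Sum.inl none))
    · rw [hessMatrix, Matrix.fromBlocks_mulVec]
      funext x
      rcases x with j | j
      · simp only [Sum.elim_inl, Matrix.zero_mulVec, add_zero, Sum.elim_comp_inl, Matrix.mulVec,
          dotProduct, Matrix.of_apply, Pi.zero_apply, Fintype.sum_option,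
          Option.elim_none, Option.elim_some, mul_one, xgrad_affinePoint]
        rw [hν]
        simp only [Finset.sum_apply, Pi.smul_apply, smul_eq_mul]
        push_cast
        rw [← Finset.sum_add_distrib]
        refine Finset.sum_eq_zero fun i _ => ?_
        ring
      · rw [hessian_sub_sum, Matrix.sub_mulVec, Matrix.sum_mulVec] at hκ
        have h1 := congrArg Complex.ofReal (congrFun hκ j)
        simp only [Pi.sub_apply, Finset.sum_apply, Matrix.smul_mulVec, Pi.smul_apply,
          smul_eq_mul] at h1
        push_cast at h1
        rw [Sum.elim_inr, Sum.elim_comp_inl, Sum.elim_comp_inr, Pi.add_apply]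
        have e1 : ∀ (A : Matrix (Fin n) (Option ι) ℂ) (w : Option ι → ℂ),
            A.mulVec w j = A j none * w none + ∑ i, A j (some i) * w (some i) := by
          intro A w
          simp [Matrix.mulVec, dotProduct, Fintype.sum_option]
        have e2 : ∀ (A : Matrix (Fin n) ι ℂ) (w : ι → ℂ), A.mulVec w j = ∑ i, A j i * w i :=
          fun A w => rfl
        simp only [e1, e2, Matrix.of_apply, Option.elim_none, Option.elim_some, hmul,
          xgrad_affinePoint, mul_one, Pi.zero_apply, mul_neg, Finset.sum_neg_distrib]
        simp only [mul_comm (Complex.ofReal (Matrix.mulVec _ _ _)),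
          mul_comm (Complex.ofReal (grad _ _ _))]
        rw [← h1]
        ring
  · have := congrArg Complex.ofReal (hv i)
    simp only [dotProduct, Complex.ofReal_sum, Complex.ofReal_mul, Complex.ofReal_zero] at this
    simp only [dotProduct, xgrad_affinePoint]
    exact this

end Dehomogenization

/-! ### Optimality conditions for nondegenerate inputs, genericity, and the overdetermined case -/

namespace Input

variable {n m₁ m₂ d₀ : ℕ} {d : Fin m₁ → ℕ} {d' : Fin m₂ → ℕ}

theorem dehom_fH (P : Input n d₀ d d') : dehom P.fH = P.f := dehom_homog _ _

theorem dehom_famH_inl (P : Input n d₀ d d') (T : Finset (Fin m₂)) (i : Fin m₁) :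
    dehom (P.famH T (Sum.inl i)) = P.h i := dehom_homog _ _

theorem dehom_famH_inr (P : Input n d₀ d d') (T : Finset (Fin m₂)) (j : T) :
    dehom (P.famH T (Sum.inr j)) = P.g j := dehom_homog _ _

theorem eval_dehom_famH_eq_zero {P : Input n d₀ d d'} {u : Fin n → ℝ} (hu : u ∈ P.feasible)
    {T : Finset (Fin m₂)} (hT : T ⊆ P.active u) (i : Fin m₁ ⊕ T) :
    eval u (dehom (P.famH T i)) = 0 := by
  rcases i with i | j
  · rw [dehom_famH_inl]
    exact hu.1 i
  · rw [dehom_famH_inr]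
    exact (Finset.mem_filter.1 (hT j.2)).2

theorem famH_isHomogeneous (P : Input n d₀ d d') (T : Finset (Fin m₂)) (i : Fin m₁ ⊕ T) :
    (P.famH T i).IsHomogeneous (degs d₀ d d' (famIdx T i)) := by
  rw [famH_eq_form]
  exact form_isHomogeneous _ _ _

theorem cqc_iff (P : Input n d₀ d d') (u : Fin n → ℝ) :
    P.CQC u ↔ LinearIndependent ℝ fun i => grad (dehom (P.famH (P.active u) i)) u := by
  have : (Sum.elim (fun i => grad (P.h i : MvPolynomial (Fin n) ℝ) u)
      fun j : P.active u => grad (P.g j : MvPolynomial (Fin n) ℝ) u) =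
      fun i => grad (dehom (P.famH (P.active u) i)) u := by
    funext i
    rcases i with i | j
    · rw [dehom_famH_inl]; rfl
    · rw [dehom_famH_inr]; rfl
  rw [CQC, this]

/-- Near a feasible point, only the active constraints matter. -/
theorem IsLocalMinimizer.isLocalMinOn {P : Input n d₀ d d'} {u : Fin n → ℝ}
    (h : P.IsLocalMinimizer u) {S : Set (Fin n → ℝ)}
    (hS : ∀ x ∈ S, (∀ i, eval x (P.h i : MvPolynomial (Fin n) ℝ) = 0) ∧
      ∀ j ∈ P.active u, 0 ≤ eval x (P.g j : MvPolynomial (Fin n) ℝ)) :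
    IsLocalMinOn (fun x => eval x (dehom P.fH)) S u := by
  have h1 : ∀ᶠ x in 𝓝 u, ∀ j, j ∉ P.active u →
      0 < eval x (P.g j : MvPolynomial (Fin n) ℝ) := by
    refine eventually_all.2 fun j => ?_
    by_cases hj : j ∈ P.active u
    · exact Eventually.of_forall fun x h => absurd hj h
    · have h2 : 0 < eval u (P.g j : MvPolynomial (Fin n) ℝ) :=
        lt_of_le_of_ne (h.1.2 j) fun h => hj (Finset.mem_filter.2 ⟨Finset.mem_univ _, h.symm⟩)
      filter_upwards [(MvPolynomial.continuous_eval _).continuousAt.eventually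
        (lt_mem_nhds h2)] with x hx _ using hx
  refine eventually_nhdsWithin_iff.2 ?_
  filter_upwards [h1, eventually_nhdsWithin_iff.1 h.2] with x h2 h3 hx
  rw [dehom_fH]
  refine h3 ⟨(hS x hx).1, fun j => ?_⟩
  by_cases hj : j ∈ P.active u
  · exact (hS x hx).2 j hj
  · exact (h2 j hj).le

theorem optimalityConditionsHold_of_nondegenerate {P : Input n d₀ d d'} (hm : m₁ ≤ n)
    (hP : ∀ x, ¬P.Degenerate x) : P.OptimalityConditionsHold := by
  classical
  intro u hu
  set J := P.active u with hJ
  have hzero := eval_dehom_famH_eq_zero hu.1 (subset_refl J)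
  have hcard : m₁ + J.card ≤ n := by
    by_contra hlt
    -- A subset of the active set that completes the equations to exactly `n + 1` members, as the
    -- resultants require.
    obtain ⟨T, hTJ, hT⟩ := Finset.exists_subset_card_eq (s := J) (n := n + 1 - m₁) (by omega)
    exact hP (.res T (by omega))
      (hasCommonZero_of_eval_eq_zero (eval_dehom_famH_eq_zero hu.1 hTJ))
  have hli : LinearIndependent ℝ fun i => grad (dehom (P.famH J i)) u := by
    by_contra h
    exact hP (.disc J hcard)
      (hasSingularZero_of_not_linearIndependent (P.famH_isHomogeneous J) hzero h)
  have hmin : IsLocalMinOn (fun x => eval x (dehom P.fH))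
      {x | ∀ i, eval x (dehom (P.famH J i)) = 0} u := by
    refine hu.isLocalMinOn fun x hx => ⟨fun i => ?_, fun j hj => ?_⟩
    · rw [← dehom_famH_inl P J]
      exact hx _
    · rw [← dehom_famH_inr P J ⟨j, hj⟩]
      exact (hx _).ge
  obtain ⟨ν, hν⟩ := exists_multipliers hli hzero hmin
  have hne : ∀ k, ν k ≠ 0 := fun k hk =>
    hP (.kkt J hcard k) (kktMeets_of_multiplier_eq_zero hzero hν hk)
  have hpos : ∀ j : J, 0 < ν (Sum.inr j) := by
    intro j
    refine lt_of_le_of_ne (multiplier_nonneg hli hzero ?_ hν) (hne _).symm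
    refine hu.isLocalMinOn fun x hx => ⟨fun i => ?_, fun k hk => ?_⟩
    · rw [← dehom_famH_inl P J]
      exact hx.1 _ Sum.inl_ne_inr
    · rw [← dehom_famH_inr P J ⟨k, hk⟩]
      by_cases hkj : (⟨k, hk⟩ : J) = j
      · rw [hkj]
        exact hx.2
      · exact (hx.1 _ fun h => hkj (Sum.inr_injective h)).ge
  -- Inactive constraints get the multiplier zero, as complementarity demands.
  let mu : Fin m₂ → ℝ := fun j => if hj : j ∈ J then ν (Sum.inr ⟨j, hj⟩) else 0
  have hmu : ∀ j : J, mu j = ν (Sum.inr j) := fun j => dif_pos j.2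
  have hmu' : ∀ j, j ∉ J → mu j = 0 := fun j hj => dif_neg hj
  have hJ0 : ∀ j ∈ J, eval u (P.g j : MvPolynomial (Fin n) ℝ) = 0 := fun j hj =>
    (Finset.mem_filter.1 hj).2
  have hL : P.lagrangian u (fun i => ν (Sum.inl i)) mu =
      dehom P.fH - ∑ i, C (ν i) * dehom (P.famH J i) := by
    rw [lagrangian, dehom_fH, Fintype.sum_sum_type, ← sub_sub, ← hJ,
      ← Finset.sum_coe_sort J]
    simp only [dehom_famH_inl, dehom_famH_inr, hmu]
  refine ⟨(P.cqc_iff u).2 hli, fun i => ν (Sum.inl i), mu, ⟨?_, fun j => ?_, fun j => ?_⟩,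
    fun j => ?_, fun v hv0 hvh hvg => ?_⟩
  · rw [← dehom_fH, hν, Fintype.sum_sum_type]
    simp only [dehom_famH_inl, dehom_famH_inr]
    congr 1
    rw [← Finset.sum_subset (Finset.subset_univ J) (fun j _ hj => by rw [hmu' j hj, zero_smul]),
      ← Finset.sum_coe_sort J]
    simp only [hmu]
  · by_cases hj : j ∈ J
    · rw [hJ0 j hj, mul_zero]
    · rw [hmu' j hj, zero_mul]
  · by_cases hj : j ∈ J
    · exact (hmu ⟨j, hj⟩).symm ▸ (hpos ⟨j, hj⟩).le
    · exact (hmu' j hj).ge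
  · by_cases hj : j ∈ J
    · rw [hJ0 j hj, add_zero]
      exact (hmu ⟨j, hj⟩).symm ▸ hpos ⟨j, hj⟩
    · rw [hmu' j hj, zero_add]
      exact lt_of_le_of_ne (hu.1.2 j) fun h =>
        hj (Finset.mem_filter.2 ⟨Finset.mem_univ _, h.symm⟩)
  · have hv : ∀ i, grad (dehom (P.famH J i)) u ⬝ᵥ v = 0 := by
      rintro (i | j)
      · rw [dehom_famH_inl]
        exact hvh i
      · rw [dehom_famH_inr]
        exact hvg j j.2
    rw [hL]
    -- Equality would make `v` isotropic for a form that is nonnegative on the tangent space, hence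
    -- mapped into the span of the gradients, which is the degeneracy described by `𝓓`.
    refine lt_of_le_of_ne (hessian_nonneg_of_tangent hli hzero hmin hν hv) fun h0 => ?_
    obtain ⟨κ, hκ⟩ := exists_mulVec_eq_sum_smul (hessian_symm _ u)
      (fun w hw => hessian_nonneg_of_tangent hli hzero hmin hν hw) hv h0.symm
    exact hP (.hess J hcard) (kktSingular_of_hessian_mulVec hzero hν hv0 hv hκ)

theorem exists_coeffs_eq (c : CoeffVar n d₀ d d' → ℝ) : ∃ P : Input n d₀ d d', P.coeffs = c := by
  obtain ⟨P, hP⟩ := exists_famCoeffs_eq (d₀ := d₀) (d := d) (d' := d') (c ∘ toVar)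
  refine ⟨P, funext ?_⟩
  rintro (α | ⟨i, α⟩ | ⟨j, α⟩)
  · exact congrFun hP ⟨none, α⟩
  · exact congrFun hP ⟨some (Sum.inl i), α⟩
  · exact congrFun hP ⟨some (Sum.inr j), α⟩

/-- The product of the polynomials is nonzero and stays so over `ℝ`, an infinite field, so it is
nonzero at some real coefficient vector, and every such vector comes from an input. -/
theorem exists_forall_aeval_coeffs_ne_zero {ι : Type*} [Fintype ι]
    {φ : ι → MvPolynomial (CoeffVar n d₀ d d') ℤ} (hφ : ∀ l, φ l ≠ 0) :
    ∃ P : Input n d₀ d d', ∀ l, aeval P.coeffs (φ l) ≠ 0 := by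
  have h1 : map (Int.castRingHom ℝ) (∏ l, φ l) ≠ 0 := by
    rw [Ne, map_eq_zero_iff _ (map_injective _ Int.cast_injective)]
    exact Finset.prod_ne_zero_iff.2 fun l _ => hφ l
  obtain ⟨c, hc⟩ : ∃ c, eval c (map (Int.castRingHom ℝ) (∏ l, φ l)) ≠ 0 := by
    by_contra! h
    exact h1 (MvPolynomial.funext fun c => by rw [h c, map_zero])
  obtain ⟨P, rfl⟩ := exists_coeffs_eq c
  refine ⟨P, fun l hl => hc ?_⟩
  rw [map_prod, map_prod]
  refine Finset.prod_eq_zero (Finset.mem_univ l) ?_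
  rw [eval_map]
  exact hl

theorem isZariskiOpen_forall_aeval_ne_zero {ι : Type*} [Fintype ι]
    (φ : ι → MvPolynomial (CoeffVar n d₀ d d') ℤ) :
    IsZariskiOpen {P : Input n d₀ d d' | ∀ l, aeval P.coeffs (φ l) ≠ 0} := by
  refine ⟨{∏ l, map (Int.castRingHom ℝ) (φ l)}, Set.ext fun P => ?_⟩
  simp only [Set.mem_ofPred_eq, Set.mem_singleton_iff, exists_eq_left, map_prod, eval_map,
    Finset.prod_ne_zero_iff, Finset.mem_univ, true_imp_iff]
  rfl

/-- The overdetermined case: a resultant whose nonvanishing makes the problem infeasible. -/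
theorem exists_polynomial_feasible_eq_empty (hd₀ : 0 < d₀) (hd : ∀ i, 0 < d i)
    (hd' : ∀ j, 0 < d' j) (hm : n < m₁) :
    ∃ φ : MvPolynomial (CoeffVar n d₀ d d') ℤ, φ ≠ 0 ∧ ∀ P : Input n d₀ d d',
      aeval P.coeffs φ ≠ 0 → P.feasible = ∅ := by
  have he : ∀ i, 0 < degs d₀ d d' i := by
    rintro (_ | i | j)
    · exact hd₀
    · exact hd i
    · exact hd' j
  let o : Fin (n + 1) → Option (Fin m₁ ⊕ Fin m₂) := fun i => some (Sum.inl (Fin.castLE hm i))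
  have ho : Function.Injective o := (Option.some_injective _).comp
    (Sum.inl_injective.comp (Fin.castLE_injective hm))
  obtain ⟨φ, h0, h⟩ := exists_polynomial_of_thin
    (D := fun P : Input n d₀ d d' => HasCommonZero fun i => form (degs d₀ d d') (o i) P.famCoeffs)
    (fun _ => Iff.rfl)
    (exists_polynomial_hasCommonZero _ o) (thin_dependentLocus he ho ho le_rfl)
    fun c hc => mem_dependentLocus_of_hasCommonZero (by simp) hc
  refine ⟨φ, h0, fun P hP => Set.eq_empty_iff_forall_notMem.2 fun u hu => hP ((h P).2 ?_)⟩
  refine hasCommonZero_of_eval_eq_zero (u := u) fun i => ?_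
  have := P.famH_eq_form ∅ (Sum.inl (Fin.castLE hm i))
  rw [show form (degs d₀ d d') (o i) P.famCoeffs = P.famH ∅ (Sum.inl (Fin.castLE hm i)) from
    this.symm, dehom_famH_inl]
  exact hu.1 _

end Input

end PolyOpt

end

theorem theorem1p2 (n m₁ m₂ d₀ : ℕ) (d : Fin m₁ → ℕ) (d' : Fin m₂ → ℕ)
    (hd₀ : 0 < d₀) (hd : ∀ i, 0 < d i) (hd' : ∀ j, 0 < d' j) :
    ∃ (L : ℕ) (φ : Fin L → MvPolynomial (PolyOpt.CoeffVar n d₀ d d') ℤ),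
      (∀ l, φ l ≠ 0) ∧
      (m₁ ≤ n → ∃ e : Fin L ≃ PolyOpt.CondIndex n m₁ m₂,
        ∀ (l : Fin L) (P : PolyOpt.Input n d₀ d d'),
          MvPolynomial.aeval P.coeffs (φ l) = 0 ↔ P.Degenerate (e l)) ∧
      (∀ P : PolyOpt.Input n d₀ d d', (∀ l, MvPolynomial.aeval P.coeffs (φ l) ≠ 0) →
        P.OptimalityConditionsHold) ∧
      PolyOpt.IsZariskiOpen
        {P : PolyOpt.Input n d₀ d d' | ∀ l, MvPolynomial.aeval P.coeffs (φ l) ≠ 0} ∧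
      {P : PolyOpt.Input n d₀ d d' | ∀ l, MvPolynomial.aeval P.coeffs (φ l) ≠ 0}.Nonempty := by
  by_cases hm : m₁ ≤ n
  · let e := (Finite.equivFin (PolyOpt.CondIndex n m₁ m₂)).symm
    choose φ h0 hφ using PolyOpt.Input.exists_polynomial_degenerate hd₀ hd hd' (n := n)
    refine ⟨_, fun l => φ (e l), fun l => h0 _, fun _ => ⟨e, fun l P => hφ _ P⟩, fun P hP => ?_,
      PolyOpt.Input.isZariskiOpen_forall_aeval_ne_zero _,
      PolyOpt.Input.exists_forall_aeval_coeffs_ne_zero fun l => h0 _⟩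
    refine PolyOpt.Input.optimalityConditionsHold_of_nondegenerate hm fun x hx => ?_
    refine hP (e.symm x) ((hφ _ P).2 ?_)
    rwa [e.apply_symm_apply]
  -- For `m₁ > n` a single polynomial suffices: where it is nonzero the problem is infeasible and
  -- has no local minimizers.
  · obtain ⟨φ, h0, hφ⟩ :=
      PolyOpt.Input.exists_polynomial_feasible_eq_empty hd₀ hd hd' (not_le.1 hm)
    refine ⟨1, fun _ => φ, fun _ => h0, fun h => absurd h hm, fun P hP u hu => ?_,
      PolyOpt.Input.isZariskiOpen_forall_aeval_ne_zero _,
      PolyOpt.Input.exists_forall_aeval_coeffs_ne_zero fun _ => h0⟩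
    have := hu.1
    rw [hφ P (hP 0)] at this
    exact this.elim
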